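/- Let $k>3$ be an odd integer. For $Z=\begin{pmatrix}\tau&z\\z&\tau'\end{pmatrix}=X+iY$ in the Siegel upper half space $\mathbb H^{(2)}$ of degree two (complex symmetric $2\times2$ matrices $Z$ with real part $X$ and positive definite imaginary part $Y$) put $$\partial_Z=\begin{pmatrix}\partial_\tau&\tfrac12\partial_z\\\tfrac12\partial_z&\partial_{\tau'}\end{pmatrix},\qquad \partial_{\overline Z}=\begin{pmatrix}\partial_{\overline\tau}&\tfrac12\partial_{\overline z}\\\tfrac12\partial_{\overline z}&\partial_{\overline{\tau'}}\end{pmatrix}.$$ A smooth function $F:\mathbb H^{(2)}\to\mathbb C$ is called weight $k$ skew-harmonic if $\Omega_kF=0$ and $\xi_kF=0$, where $$\Omega_k=-4Y\,{}^{t}\big(Y\partial_{\overline Z}\big)\partial_Z-i(2k-1)Y\partial_Z+iY\partial_{\overline Z},\qquad \xi_k=\det(Y)^{k-\frac32}\det(Z-\overline Z)\big(\partial_\tau\partial_{\tau'}-\tfrac14\partial_z^2\big).$$ It is said to have moderate growth if for every $\varepsilon>0$ there is $r\in\mathbb R$ such that $F(Z)=O(\mathrm{tr}(Y)^r)$ as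 $\mathrm{tr}(Y)\to\infty$ in the region where $Y-\varepsilon I$ is positive semi-definite. Write $e(TX)=\exp(2\pi i\,\mathrm{tr}(TX))$, and let $W_{\kappa,\mu}$ be the $W$-Whittaker function. (1) Let $T\neq0$ be a real symmetric $2\times2$ matrix that is negative semi-definite with $\det T=0$. If $a(Y)\,e(TX)$ is weight $k$ skew-harmonic and of moderate growth, then the function $a$ on positive definite $Y$ is a complex linear combination of the two linearly independent functions $$\det(Y)^{\frac32-k}\,\mathrm{tr}(TY)^{k-2}\,e^{-2\pi|\mathrm{tr}(TY)|}\qquad\text{and}\qquad\big(4\pi|\mathrm{tr}(TY)|\big)^{-\frac k2}\,W_{\frac{k-1}2,\frac{k-1}2}\big(4\pi|\mathrm{tr}(TY)|\big).$$ (2) Let $T$ be a real symmetric negative definite $2\times2$ matrix. If $a(Y)\,e(TX)$ is weight $k$ skew-harmonic and of moderate growth, then $a$ is unique up to scalar multiples: the space of all such functions $a$ on positive definite $Y$ is at most one-dimensional. -/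

import Mathlib

open Complex Matrix Set Filter Asymptotics
open scoped ContDiff Matrix

noncomputable section

namespace SkewSiegel

/-- A triple `p = (τ, z, τ')` of complex numbers stands for the symmetric matrix `Z` with rows
`(τ, z)` and `(z, τ')`. -/
def matZ (p : ℂ × ℂ × ℂ) : Matrix (Fin 2) (Fin 2) ℂ :=
  !![p.1, p.2.1; p.2.1, p.2.2]

/-- The real part `X` of `Z`. -/
def matX (p : ℂ × ℂ × ℂ) : Matrix (Fin 2) (Fin 2) ℝ := (matZ p).map Complex.re

/-- The imaginary part `Y` of `Z`. -/
def matY (p : ℂ × ℂ × ℂ) : Matrix (Fin 2) (Fin 2) ℝ := (matZ p).map Complex.im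

/-- The Siegel upper half space of degree two, in the coordinates `(τ, z, τ')`. -/
def siegelUpperHalfSpace : Set (ℂ × ℂ × ℂ) := {p | (matY p).PosDef}

/-- The Wirtinger derivative `∂/∂w = (∂/∂a - i ∂/∂b) / 2` along the complex direction `e`. -/
def wirtinger (e : ℂ × ℂ × ℂ) (F : ℂ × ℂ × ℂ → ℂ) (p : ℂ × ℂ × ℂ) : ℂ :=
  (1 / 2) * (fderiv ℝ F p e - I * fderiv ℝ F p (I • e))

/-- The conjugate Wirtinger derivative `∂/∂w̄ = (∂/∂a + i ∂/∂b) / 2` along the complex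
direction `e`. -/
def wirtingerBar (e : ℂ × ℂ × ℂ) (F : ℂ × ℂ × ℂ → ℂ) (p : ℂ × ℂ × ℂ) : ℂ :=
  (1 / 2) * (fderiv ℝ F p e + I * fderiv ℝ F p (I • e))

/-- The matrix `∂_Z F` with diagonal entries `∂_τ F`, `∂_τ' F` and off-diagonal entries
`(1/2) ∂_z F`. -/
def dZ (F : ℂ × ℂ × ℂ → ℂ) (p : ℂ × ℂ × ℂ) : Matrix (Fin 2) (Fin 2) ℂ :=
  !![wirtinger (1, 0, 0) F p, (1 / 2) * wirtinger (0, 1, 0) F p;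
     (1 / 2) * wirtinger (0, 1, 0) F p, wirtinger (0, 0, 1) F p]

/-- The matrix `∂_Z̄ F`, built from the conjugate Wirtinger derivatives in the same way. -/
def dZbar (F : ℂ × ℂ × ℂ → ℂ) (p : ℂ × ℂ × ℂ) : Matrix (Fin 2) (Fin 2) ℂ :=
  !![wirtingerBar (1, 0, 0) F p, (1 / 2) * wirtingerBar (0, 1, 0) F p;
     (1 / 2) * wirtingerBar (0, 1, 0) F p, wirtingerBar (0, 0, 1) F p]

/-- The matrix-valued function `(Y ᵗ(Y ∂_Z̄) ∂_Z) F`. Its `(i, j)` entry is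
`∑ a b, Y i a * (∑ l, Y b l * ∂_Z̄ l a) (∂_Z b j F)`, because the `(a, b)` entry of `ᵗ(Y ∂_Z̄)`
is the `(b, a)` entry of `Y ∂_Z̄`. -/
def secondOrderPart (F : ℂ × ℂ × ℂ → ℂ) (p : ℂ × ℂ × ℂ) : Matrix (Fin 2) (Fin 2) ℂ :=
  Matrix.of fun i j => ∑ a : Fin 2, ∑ b : Fin 2,
    (matY p i a : ℂ) * ∑ l : Fin 2, (matY p b l : ℂ) * dZbar (fun q => dZ F q b j) p l a

/-- The matrix-valued Laplace operator
`Ω_k = -4 Y ᵗ(Y ∂_Z̄) ∂_Z - i (2k - 1) Y ∂_Z + i Y ∂_Z̄`. -/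
def skewOmega (k : ℤ) (F : ℂ × ℂ × ℂ → ℂ) (p : ℂ × ℂ × ℂ) : Matrix (Fin 2) (Fin 2) ℂ :=
  (-4 : ℂ) • secondOrderPart F p
    - (I * (2 * (k : ℂ) - 1)) • ((matY p).map ((↑) : ℝ → ℂ) * dZ F p)
    + I • ((matY p).map ((↑) : ℝ → ℂ) * dZbar F p)

/-- The operator `ξ_k = det(Y)^(k - 3/2) det(Z - Z̄) (∂_τ ∂_τ' - (1/4) ∂_z²)`. -/
def skewXi (k : ℤ) (F : ℂ × ℂ × ℂ → ℂ) (p : ℂ × ℂ × ℂ) : ℂ :=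
  (((matY p).det ^ ((k : ℝ) - 3 / 2) : ℝ) : ℂ)
    * (matZ p - (matZ p).map (starRingEnd ℂ)).det
    * (wirtinger (1, 0, 0) (wirtinger (0, 0, 1) F) p
        - (1 / 4) * wirtinger (0, 1, 0) (wirtinger (0, 1, 0) F) p)

/-- Weight `k` skew-harmonic functions on the Siegel upper half space (values outside of it
are irrelevant). -/
def IsSkewHarmonic (k : ℤ) (F : ℂ × ℂ × ℂ → ℂ) : Prop :=
  ContDiffOn ℝ ∞ F siegelUpperHalfSpace ∧
    ∀ p ∈ siegelUpperHalfSpace, skewOmega k F p = 0 ∧ skewXi k F p = 0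

/-- Moderate growth: on every region `Y ≥ ε` with `ε > 0` one has `F(Z) = O(tr(Y)^r)` for some
real `r` as `tr(Y) → ∞`. -/
def HasModerateGrowth (F : ℂ × ℂ × ℂ → ℂ) : Prop :=
  ∀ ε : ℝ, 0 < ε → ∃ r : ℝ,
    F =O[comap (fun p => (matY p).trace) atTop ⊓
        𝓟 {p | (matY p - ε • (1 : Matrix (Fin 2) (Fin 2) ℝ)).PosSemidef}]
      fun p => (matY p).trace ^ r

/-- The Fourier term `a(Y) e(TX)`, where `e(TX) = exp(2 π i tr(TX))`. -/
def fourierTerm (T : Matrix (Fin 2) (Fin 2) ℝ) (a : Matrix (Fin 2) (Fin 2) ℝ → ℂ)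
    (p : ℂ × ℂ × ℂ) : ℂ :=
  a (matY p) * Complex.exp (2 * (Real.pi : ℂ) * I * ((T * matX p).trace : ℂ))

/-- The `W`-Whittaker function `W_{κ,μ}(x)` for real `κ`, `μ` with `μ - κ + 1/2 > 0` and `x > 0`,
through its standard integral representation. Only this range of parameters is used. -/
def whittakerW (κ μ x : ℝ) : ℝ :=
  Real.exp (-x / 2) * x ^ (μ + 1 / 2) / Real.Gamma (μ - κ + 1 / 2) *
    ∫ t in Ioi (0 : ℝ),
      Real.exp (-x * t) * t ^ (μ - κ - 1 / 2) * (1 + t) ^ (μ + κ - 1 / 2)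

/-- `det(Y)^(3/2 - k) tr(TY)^(k - 2) exp(-2 π |tr(TY)|)`. -/
def detTerm (k : ℤ) (T Y : Matrix (Fin 2) (Fin 2) ℝ) : ℝ :=
  Y.det ^ (3 / 2 - (k : ℝ)) * (T * Y).trace ^ (k - 2) *
    Real.exp (-(2 * Real.pi * |(T * Y).trace|))

/-- `(4 π |tr(TY)|)^(-k/2) W_{(k-1)/2, (k-1)/2}(4 π |tr(TY)|)`. -/
def whittakerTerm (k : ℤ) (T Y : Matrix (Fin 2) (Fin 2) ℝ) : ℝ :=
  (4 * Real.pi * |(T * Y).trace|) ^ (-((k : ℝ) / 2)) *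
    whittakerW (((k : ℝ) - 1) / 2) (((k : ℝ) - 1) / 2) (4 * Real.pi * |(T * Y).trace|)

end SkewSiegel

end

/-!
Let `b` be the function `a` in the coordinates `(x, y, w)` of `Y`, and `S = 2πT`. On `b(Y) e(TX)` the
matrices `∂_Z` and `∂_Z̄` act as `(i/2)(S - ∂)` and `(i/2)(S + ∂)`, so `Ω_k F = 0` becomes, after
cancelling the invertible matrix `Y`,
`∂ Y ∂ b + k ∂ b + (S Y ∂ b - ᵗ(S Y ∂ b)) = (S Y S + (k - 1) S) b`
(the outer `∂` not acting on `Y`), and `ξ_k F = 0` becomes `det(S - ∂) b = 0`. The symmetric and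
antisymmetric parts give the system `IsSkewSystem`, see `IsSkewHarmonic.isSkewSystem`. It has real
coefficients, so real and imaginary parts can be treated separately, and it is equivariant under
`Y ↦ g Y ᵗg` (`IsSkewSystem.comp_congrMap`), so `S` may be taken to be `diag(-1, 0)` or `-1`.

For `S = diag(-1, 0)` the symmetry of `S Y ∂ b` says that `b` depends on `x` and `det Y` only. Two
first-order equations determine `b_w` up to a scalar, which splits off the determinant term. What
remains is a function `A(x)` with `x A'' + k A' = (x - k + 1) A`. Its decaying solution is the
Whittaker term, and by the Wronskian any solution of polynomial growth is a multiple of it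
(`eq_mul_decayingSolution_of_growth`).

For `S = -1` the symmetry says that `b` is invariant under rotations, so it is determined by its
values on diagonal matrices. On scalar matrices `h(u) = b(u, 0, u)` satisfies
`(u h' + (k - 1) h)' = -2 (u h' + (k - 1) h)`. If the linear functional `h'(1) + (k - 1) h(1)`
vanishes, then `h` is a multiple of `u^(1 - k)`. Off the scalar matrices, with `w = t` fixed,
`e^x b` and its derivatives satisfy an ordinary differential system in `x` with a regular singularity
at `x = t` (`IsRadialSystem`). If `h = 0`, Gronwall's argument gives `b = 0`. If `h = u^(1 - k)`, all
quantities stay positive and `b(3t, 0, t)` is at least a constant times `t^(-k) e^(2t)`, which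
contradicts moderate growth along a ray. So the functional is injective on the solutions of moderate
growth, and these form a space of dimension at most one.
-/

namespace SkewSiegel

/-! ### Coordinates on real symmetric matrices -/

/-- The cone of positive definite real symmetric matrices with rows `(x, y)` and `(y, w)`, in the
coordinates `(x, y, w)`. -/
def posCone : Set (ℝ × ℝ × ℝ) := {v | 0 < v.1 ∧ 0 < v.1 * v.2.2 - v.2.1 ^ 2}

/-- The symmetric matrix with rows `(x, y)` and `(y, w)`. -/
def symMat (v : ℝ × ℝ × ℝ) : Matrix (Fin 2) (Fin 2) ℝ := !![v.1, v.2.1; v.2.1, v.2.2]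

theorem isOpen_posCone : IsOpen posCone := by
  have h1 : IsOpen {v : ℝ × ℝ × ℝ | 0 < v.1} := isOpen_lt (by fun_prop) (by fun_prop)
  have h2 : IsOpen {v : ℝ × ℝ × ℝ | 0 < v.1 * v.2.2 - v.2.1 ^ 2} :=
    isOpen_lt (by fun_prop) (by fun_prop)
  exact h1.inter h2

theorem posCone_pos_right {v : ℝ × ℝ × ℝ} (hv : v ∈ posCone) : 0 < v.2.2 := by
  obtain ⟨h1, h2⟩ := hv
  by_contra! h
  nlinarith [sq_nonneg v.2.1]

theorem posCone_diag {x w : ℝ} (hx : 0 < x) (hw : 0 < w) : (x, (0 : ℝ), w) ∈ posCone :=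
  ⟨hx, by simpa using mul_pos hx hw⟩

theorem symMat_isHermitian (v : ℝ × ℝ × ℝ) : (symMat v).IsHermitian := by
  ext i j
  fin_cases i <;> fin_cases j <;> simp [symMat]

theorem symMat_posSemidef {v : ℝ × ℝ × ℝ} (h1 : 0 ≤ v.1) (h3 : 0 ≤ v.2.2)
    (hd : 0 ≤ v.1 * v.2.2 - v.2.1 ^ 2) : (symMat v).PosSemidef := by
  refine Matrix.posSemidef_iff_dotProduct_mulVec.2 ⟨symMat_isHermitian v, fun u => ?_⟩
  simp only [symMat, dotProduct, mulVec, Fin.sum_univ_two, Pi.star_apply, star_trivial, of_apply,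
    cons_val', cons_val_zero, cons_val_one, cons_val_fin_one]
  rcases h1.lt_or_eq with h | h
  · have : 0 ≤ v.1 * (u 0 * (v.1 * u 0 + v.2.1 * u 1) + u 1 * (v.2.1 * u 0 + v.2.2 * u 1)) := by
      nlinarith [sq_nonneg (v.1 * u 0 + v.2.1 * u 1), mul_nonneg hd (sq_nonneg (u 1))]
    exact nonneg_of_mul_nonneg_right this h
  · have h2 : v.2.1 = 0 := by
      rw [← h] at hd
      nlinarith [sq_nonneg v.2.1]
    rw [← h, h2]
    nlinarith [mul_nonneg h3 (sq_nonneg (u 1))]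

theorem posDef_symMat_iff {v : ℝ × ℝ × ℝ} : (symMat v).PosDef ↔ v ∈ posCone := by
  constructor
  · intro h
    refine ⟨by simpa [symMat] using h.diag_pos (i := 0), ?_⟩
    have := h.det_pos
    rw [symMat, Matrix.det_fin_two_of] at this
    nlinarith
  · rintro ⟨h1, h2⟩
    refine Matrix.posDef_iff_dotProduct_mulVec.2 ⟨symMat_isHermitian v, fun u hu => ?_⟩
    simp only [symMat, dotProduct, mulVec, Fin.sum_univ_two, Pi.star_apply, star_trivial, of_apply,
      cons_val', cons_val_zero, cons_val_one, cons_val_fin_one]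
    have : 0 < v.1 * (u 0 * (v.1 * u 0 + v.2.1 * u 1) + u 1 * (v.2.1 * u 0 + v.2.2 * u 1)) := by
      by_cases hu1 : u 1 = 0
      · have hu0 : u 0 ≠ 0 := fun h0 => hu (by ext i; fin_cases i <;> simp [h0, hu1])
        have : 0 < (v.1 * u 0) ^ 2 := by positivity
        rw [hu1]
        nlinarith
      · have : 0 < (v.1 * v.2.2 - v.2.1 ^ 2) * u 1 ^ 2 := by positivity
        nlinarith [sq_nonneg (v.1 * u 0 + v.2.1 * u 1)]
    exact pos_of_mul_pos_right this h1.le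

theorem eq_symMat_of_isHermitian {Y : Matrix (Fin 2) (Fin 2) ℝ} (hY : Y.IsHermitian) :
    Y = symMat (Y 0 0, Y 0 1, Y 1 1) := by
  have : Y 1 0 = Y 0 1 := by simpa using hY.apply 0 1
  ext i j
  fin_cases i <;> fin_cases j <;> simp [symMat, this]

theorem det_symMat (v : ℝ × ℝ × ℝ) : (symMat v).det = v.1 * v.2.2 - v.2.1 ^ 2 := by
  rw [symMat, Matrix.det_fin_two_of]; ring

/-! ### Directional derivatives -/

section Deriv

variable {E : Type*} [NormedAddCommGroup E] [NormedSpace ℝ E]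

/-- The derivative of `b` in the direction `e`. -/
noncomputable def dirDeriv (e : ℝ × ℝ × ℝ) (b : ℝ × ℝ × ℝ → E) (v : ℝ × ℝ × ℝ) : E :=
  fderiv ℝ b v e

/-- The partial derivative in the first coordinate `x`. -/
noncomputable abbrev pdX (b : ℝ × ℝ × ℝ → E) : ℝ × ℝ × ℝ → E := dirDeriv (1, 0, 0) b

/-- The partial derivative in the second coordinate `y`. -/
noncomputable abbrev pdY (b : ℝ × ℝ × ℝ → E) : ℝ × ℝ × ℝ → E := dirDeriv (0, 1, 0) b

/-- The partial derivative in the third coordinate `w`. -/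
noncomputable abbrev pdW (b : ℝ × ℝ × ℝ → E) : ℝ × ℝ × ℝ → E := dirDeriv (0, 0, 1) b

variable {b : ℝ × ℝ × ℝ → E}

theorem contDiffOn_dirDeriv (hb : ContDiffOn ℝ ∞ b posCone) (e : ℝ × ℝ × ℝ) :
    ContDiffOn ℝ ∞ (dirDeriv e b) posCone :=
  (hb.fderiv_of_isOpen isOpen_posCone (by simp)).clm_apply contDiffOn_const

theorem differentiableAt_of_mem_posCone (hb : ContDiffOn ℝ ∞ b posCone) {v : ℝ × ℝ × ℝ}
    (hv : v ∈ posCone) : DifferentiableAt ℝ b v :=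
  (hb.contDiffAt (isOpen_posCone.mem_nhds hv)).differentiableAt (by simp)

theorem dirDeriv_expand (e : ℝ × ℝ × ℝ) (b : ℝ × ℝ × ℝ → E) (v : ℝ × ℝ × ℝ) :
    dirDeriv e b v = e.1 • pdX b v + e.2.1 • pdY b v + e.2.2 • pdW b v := by
  simp only [dirDeriv, ← map_smul, ← map_add]
  congr 1
  simp

theorem dirDeriv_comm (hb : ContDiffOn ℝ ∞ b posCone) {v : ℝ × ℝ × ℝ} (hv : v ∈ posCone)
    (e e' : ℝ × ℝ × ℝ) : dirDeriv e (dirDeriv e' b) v = dirDeriv e' (dirDeriv e b) v := by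
  have h1 : DifferentiableAt ℝ (fderiv ℝ b) v :=
    ((hb.fderiv_of_isOpen isOpen_posCone (m := ∞) (by simp)).contDiffAt
      (isOpen_posCone.mem_nhds hv)).differentiableAt (by simp)
  have h2 : ∀ e e' : ℝ × ℝ × ℝ,
      dirDeriv e (dirDeriv e' b) v = fderiv ℝ (fderiv ℝ b) v e e' := by
    intro e e'
    have : HasFDerivAt (dirDeriv e' b) _ v := h1.hasFDerivAt.clm_apply (hasFDerivAt_const e' v)
    rw [dirDeriv, this.fderiv]
    simp
  rw [h2, h2]
  have hmin : minSmoothness ℝ 2 ≤ (∞ : WithTop ℕ∞) := by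
    rw [minSmoothness_of_isRCLikeNormedField]
    exact WithTop.coe_le_coe.2 le_top
  exact ((hb.contDiffAt (isOpen_posCone.mem_nhds hv)).isSymmSndFDerivAt hmin) e e'

theorem dirDeriv_add_smul {b₁ b₂ b₃ : ℝ × ℝ × ℝ → E} {v : ℝ × ℝ × ℝ}
    (h₁ : DifferentiableAt ℝ b₁ v) (h₂ : DifferentiableAt ℝ b₂ v) (h₃ : DifferentiableAt ℝ b₃ v)
    (p q r : ℝ) (e : ℝ × ℝ × ℝ) :
    dirDeriv e (fun u => p • b₁ u + q • b₂ u + r • b₃ u) v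
      = p • dirDeriv e b₁ v + q • dirDeriv e b₂ v + r • dirDeriv e b₃ v := by
  have := ((h₁.hasFDerivAt.const_smul p).add (h₂.hasFDerivAt.const_smul q)).add
    (h₃.hasFDerivAt.const_smul r)
  have h : HasFDerivAt (fun u => p • b₁ u + q • b₂ u + r • b₃ u) _ v := this
  rw [dirDeriv, h.fderiv]
  simp [dirDeriv]

/-- The second derivative in two directions, expanded in the six second partial derivatives. -/
theorem dirDeriv_dirDeriv_expand (hb : ContDiffOn ℝ ∞ b posCone) {v : ℝ × ℝ × ℝ}
    (hv : v ∈ posCone) (e e' : ℝ × ℝ × ℝ) :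
    dirDeriv e (dirDeriv e' b) v
      = (e.1 * e'.1) • pdX (pdX b) v + (e.1 * e'.2.1 + e.2.1 * e'.1) • pdX (pdY b) v
        + (e.1 * e'.2.2 + e.2.2 * e'.1) • pdX (pdW b) v + (e.2.1 * e'.2.1) • pdY (pdY b) v
        + (e.2.1 * e'.2.2 + e.2.2 * e'.2.1) • pdY (pdW b) v
        + (e.2.2 * e'.2.2) • pdW (pdW b) v := by
  have hd : ∀ e, DifferentiableAt ℝ (dirDeriv e b) v := fun e =>
    differentiableAt_of_mem_posCone (contDiffOn_dirDeriv hb e) hv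
  have h : dirDeriv e' b = fun u => e'.1 • pdX b u + e'.2.1 • pdY b u + e'.2.2 • pdW b u :=
    funext fun u => dirDeriv_expand e' b u
  rw [h, dirDeriv_add_smul (hd _) (hd _) (hd _), dirDeriv_expand e (pdX b),
    dirDeriv_expand e (pdY b), dirDeriv_expand e (pdW b),
    show pdY (pdX b) v = pdX (pdY b) v from dirDeriv_comm hb hv _ _,
    show pdW (pdX b) v = pdX (pdW b) v from dirDeriv_comm hb hv _ _,
    show pdW (pdY b) v = pdY (pdW b) v from dirDeriv_comm hb hv _ _]
  module

/-- The chain rule along a curve in the cone. -/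
theorem hasDerivAt_comp_curve (hb : ContDiffOn ℝ ∞ b posCone) {f g h : ℝ → ℝ} {f' g' h' t : ℝ}
    (hf : HasDerivAt f f' t) (hg : HasDerivAt g g' t) (hh : HasDerivAt h h' t)
    (hv : (f t, g t, h t) ∈ posCone) :
    HasDerivAt (fun s => b (f s, g s, h s))
      (f' • pdX b (f t, g t, h t) + g' • pdY b (f t, g t, h t) + h' • pdW b (f t, g t, h t)) t := by
  have h1 := (differentiableAt_of_mem_posCone hb hv).hasFDerivAt
  have h2 : HasDerivAt (fun s => (f s, g s, h s)) (f', g', h') t := hf.prodMk (hg.prodMk hh)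
  have h3 := h1.comp_hasDerivAt t h2
  rw [show fderiv ℝ b (f t, g t, h t) (f', g', h') = dirDeriv (f', g', h') b (f t, g t, h t) from
    rfl, dirDeriv_expand] at h3
  exact h3

theorem dirDeriv_clm_comp {G : Type*} [NormedAddCommGroup G] [NormedSpace ℝ G] (L : E →L[ℝ] G)
    (hb : ContDiffOn ℝ ∞ b posCone) {v : ℝ × ℝ × ℝ} (hv : v ∈ posCone) (e : ℝ × ℝ × ℝ) :
    dirDeriv e (fun u => L (b u)) v = L (dirDeriv e b v) := by
  have := L.hasFDerivAt.comp v (differentiableAt_of_mem_posCone hb hv).hasFDerivAt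
  rw [dirDeriv, HasFDerivAt.fderiv (f := fun u => L (b u)) this]
  rfl

theorem dirDeriv_congr {b' : ℝ × ℝ × ℝ → E} (h : EqOn b b' posCone) (e : ℝ × ℝ × ℝ) :
    EqOn (dirDeriv e b) (dirDeriv e b') posCone := by
  intro v hv
  have : b =ᶠ[nhds v] b' := h.eventuallyEq_of_mem (isOpen_posCone.mem_nhds hv)
  rw [dirDeriv, dirDeriv, this.fderiv_eq]

theorem dirDeriv_dirDeriv_clm_comp {G : Type*} [NormedAddCommGroup G] [NormedSpace ℝ G]
    (L : E →L[ℝ] G) (hb : ContDiffOn ℝ ∞ b posCone) {v : ℝ × ℝ × ℝ} (hv : v ∈ posCone)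
    (e e' : ℝ × ℝ × ℝ) :
    dirDeriv e (dirDeriv e' (fun u => L (b u))) v = L (dirDeriv e (dirDeriv e' b) v) := by
  rw [dirDeriv_congr (fun u hu => dirDeriv_clm_comp L hb hu e') e hv,
    dirDeriv_clm_comp L (contDiffOn_dirDeriv hb e') hv]

/-- The chain rule for a linear change of coordinates preserving the cone. -/
theorem dirDeriv_comp_clm (M : ℝ × ℝ × ℝ →L[ℝ] ℝ × ℝ × ℝ) (hM : MapsTo M posCone posCone)
    (hb : ContDiffOn ℝ ∞ b posCone) {v : ℝ × ℝ × ℝ} (hv : v ∈ posCone) (e : ℝ × ℝ × ℝ) :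
    dirDeriv e (fun u => b (M u)) v = dirDeriv (M e) b (M v) := by
  have := (differentiableAt_of_mem_posCone hb (hM hv)).hasFDerivAt.comp v M.hasFDerivAt
  rw [dirDeriv, HasFDerivAt.fderiv (f := fun u => b (M u)) this]
  rfl

theorem dirDeriv_dirDeriv_comp_clm (M : ℝ × ℝ × ℝ →L[ℝ] ℝ × ℝ × ℝ)
    (hM : MapsTo M posCone posCone) (hb : ContDiffOn ℝ ∞ b posCone) {v : ℝ × ℝ × ℝ}
    (hv : v ∈ posCone) (e e' : ℝ × ℝ × ℝ) :
    dirDeriv e (dirDeriv e' (fun u => b (M u))) v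
      = dirDeriv (M e) (dirDeriv (M e') b) (M v) := by
  rw [dirDeriv_congr (fun u hu => dirDeriv_comp_clm M hM hb hu e') e hv,
    dirDeriv_comp_clm M hM (contDiffOn_dirDeriv hb _) hv]

end Deriv

/-! ### The system of equations in the imaginary part -/

section System

variable {E : Type*} [NormedAddCommGroup E] [NormedSpace ℝ E]

/-- The differential equations on the cone that express that `b(Y) e(TX)` is weight `k`
skew-harmonic. Here `S = 2πT` has rows `(s₁, s₂)` and `(s₂, s₃)`, and `∂` denotes the symmetric
matrix with entries `∂_x`, `∂_y / 2`, `∂_w`. -/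
structure IsSkewSystem (k s₁ s₂ s₃ : ℝ) (b : ℝ × ℝ × ℝ → E) : Prop where
  smooth : ContDiffOn ℝ ∞ b posCone
  /-- `det(S - ∂) b = 0` -/
  det_eq : ∀ x y w, (x, y, w) ∈ posCone →
    (s₁ * s₃ - s₂ ^ 2) • b (x, y, w) - (s₁ • pdW b (x, y, w) + s₃ • pdX b (x, y, w)
      - s₂ • pdY b (x, y, w)) + pdX (pdW b) (x, y, w) - (1 / 4 : ℝ) • pdY (pdY b) (x, y, w) = 0
  /-- `S Y ∂ b` is a symmetric matrix -/
  symm_eq : ∀ x y w, (x, y, w) ∈ posCone →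
    ((s₁ * x - s₃ * w) / 2) • pdY b (x, y, w) + (s₁ * y + s₂ * w) • pdW b (x, y, w)
      - (s₂ * x + s₃ * y) • pdX b (x, y, w) = 0
  /-- the upper left entry of `∂ Y ∂ b + k ∂ b = (S Y S + (k - 1) S) b`, where the outer `∂` does
  not act on `Y` -/
  eq_XX : ∀ x y w, (x, y, w) ∈ posCone →
    x • pdX (pdX b) (x, y, w) + y • pdX (pdY b) (x, y, w) + (w / 4) • pdY (pdY b) (x, y, w)
      + k • pdX b (x, y, w)
      = (s₁ ^ 2 * x + 2 * s₁ * s₂ * y + s₂ ^ 2 * w + (k - 1) * s₁) • b (x, y, w)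
  /-- the off-diagonal entry of the same matrix equation -/
  eq_XW : ∀ x y w, (x, y, w) ∈ posCone →
    (x / 2) • pdX (pdY b) (x, y, w) + y • pdX (pdW b) (x, y, w) + (y / 4) • pdY (pdY b) (x, y, w)
      + (w / 2) • pdY (pdW b) (x, y, w) + (k / 2) • pdY b (x, y, w)
      = (s₁ * s₂ * x + (s₁ * s₃ + s₂ ^ 2) * y + s₂ * s₃ * w + (k - 1) * s₂) • b (x, y, w)
  /-- the lower right entry of the same matrix equation -/
  eq_WW : ∀ x y w, (x, y, w) ∈ posCone →
    (x / 4) • pdY (pdY b) (x, y, w) + y • pdY (pdW b) (x, y, w) + w • pdW (pdW b) (x, y, w)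
      + k • pdW b (x, y, w)
      = (s₂ ^ 2 * x + 2 * s₂ * s₃ * y + s₃ ^ 2 * w + (k - 1) * s₃) • b (x, y, w)

variable {k s₁ s₂ s₃ : ℝ} {b : ℝ × ℝ × ℝ → E}

theorem IsSkewSystem.clm_comp {G : Type*} [NormedAddCommGroup G] [NormedSpace ℝ G]
    (L : E →L[ℝ] G) (hb : IsSkewSystem k s₁ s₂ s₃ b) :
    IsSkewSystem k s₁ s₂ s₃ (fun v => L (b v)) := by
  refine ⟨L.contDiff.comp_contDiffOn hb.smooth, ?_, ?_, ?_, ?_, ?_⟩ <;> intro x y w hv <;>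
    simp only [dirDeriv_clm_comp L hb.smooth hv, dirDeriv_dirDeriv_clm_comp L hb.smooth hv,
      ← map_smul, ← map_add, ← map_sub]
  · rw [hb.det_eq x y w hv, map_zero]
  · rw [hb.symm_eq x y w hv, map_zero]
  · rw [hb.eq_XX x y w hv]
  · rw [hb.eq_XW x y w hv]
  · rw [hb.eq_WW x y w hv]

/-- The map `Y ↦ g Y ᵗg` in the coordinates `(x, y, w)`, for `g` with rows `(p, q)`, `(r, s)`. -/
noncomputable def congrMap (p q r s : ℝ) : ℝ × ℝ × ℝ →L[ℝ] ℝ × ℝ × ℝ :=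
  LinearMap.toContinuousLinearMap
    { toFun := fun v => (p ^ 2 * v.1 + 2 * p * q * v.2.1 + q ^ 2 * v.2.2,
        p * r * v.1 + (p * s + q * r) * v.2.1 + q * s * v.2.2,
        r ^ 2 * v.1 + 2 * r * s * v.2.1 + s ^ 2 * v.2.2)
      map_add' := fun u v => by ext <;> simp <;> ring
      map_smul' := fun c v => by ext <;> simp <;> ring }

theorem congrMap_apply (p q r s : ℝ) (v : ℝ × ℝ × ℝ) :
    congrMap p q r s v = (p ^ 2 * v.1 + 2 * p * q * v.2.1 + q ^ 2 * v.2.2,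
        p * r * v.1 + (p * s + q * r) * v.2.1 + q * s * v.2.2,
        r ^ 2 * v.1 + 2 * r * s * v.2.1 + s ^ 2 * v.2.2) := rfl

theorem mapsTo_congrMap {p q r s : ℝ} (hg : p * s - q * r ≠ 0) :
    MapsTo (congrMap p q r s) posCone posCone := by
  rintro ⟨x, y, w⟩ ⟨h1, h2⟩
  simp only at h1 h2
  rw [congrMap_apply]
  refine ⟨?_, ?_⟩
  · simp only
    have : 0 < x * (p ^ 2 * x + 2 * p * q * y + q ^ 2 * w) := by
      by_cases hq : q = 0
      · have hp : p ≠ 0 := by rintro rfl; simp [hq] at hg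
        have : 0 < (p * x) ^ 2 := by positivity
        rw [hq]; nlinarith
      · have : 0 < (x * w - y ^ 2) * q ^ 2 := by positivity
        nlinarith [sq_nonneg (p * x + q * y)]
    exact pos_of_mul_pos_right this h1.le
  · have : 0 < (p * s - q * r) ^ 2 * (x * w - y ^ 2) := by positivity
    simp only
    nlinarith

/-- The system is equivariant: if `b` solves it for `S`, then `Y ↦ b(g Y ᵗg)` solves it for
`ᵗg S g`. -/
theorem IsSkewSystem.comp_congrMap (hb : IsSkewSystem k s₁ s₂ s₃ b) {p q r s : ℝ}
    (hg : p * s - q * r ≠ 0) {t₁ t₂ t₃ : ℝ}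
    (h₁ : t₁ = p ^ 2 * s₁ + 2 * p * r * s₂ + r ^ 2 * s₃)
    (h₂ : t₂ = p * q * s₁ + (p * s + q * r) * s₂ + r * s * s₃)
    (h₃ : t₃ = q ^ 2 * s₁ + 2 * q * s * s₂ + s ^ 2 * s₃) :
    IsSkewSystem k t₁ t₂ t₃ (fun v => b (congrMap p q r s v)) := by
  have hM := mapsTo_congrMap hg
  have hD : ∀ v ∈ posCone, ∀ e, dirDeriv e (fun u => b (congrMap p q r s u)) v = _ :=
    fun v hv e => (dirDeriv_comp_clm _ hM hb.smooth hv e).trans (dirDeriv_expand _ _ _)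
  have hDD : ∀ v ∈ posCone, ∀ e e',
      dirDeriv e (dirDeriv e' (fun u => b (congrMap p q r s u))) v = _ :=
    fun v hv e e' => (dirDeriv_dirDeriv_comp_clm _ hM hb.smooth hv e e').trans
      (dirDeriv_dirDeriv_expand hb.smooth (hM hv) _ _)
  subst h₁ h₂ h₃
  refine ⟨hb.smooth.comp (congrMap p q r s).contDiff.contDiffOn hM, ?_, ?_, ?_, ?_, ?_⟩ <;>
    intro x y w hv <;>
    simp only [hD _ hv, hDD _ hv] <;>
    have hv' := hM hv <;>
    simp only [congrMap_apply] at hv' ⊢ <;>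
    have e1 := hb.det_eq _ _ _ hv' <;>
    have e2 := hb.symm_eq _ _ _ hv' <;>
    have e3 := hb.eq_XX _ _ _ hv' <;>
    have e4 := hb.eq_XW _ _ _ hv' <;>
    have e5 := hb.eq_WW _ _ _ hv'
  · linear_combination (norm := module) ((p * s - q * r) ^ 2) • e1
  · linear_combination (norm := module) (p * s - q * r) • e2
  · linear_combination (norm := module) (p ^ 2) • e3 + (2 * p * r) • e4 + (r ^ 2) • e5
  · linear_combination (norm := module) (p * q) • e3 + (p * s + q * r) • e4 + (r * s) • e5
  · linear_combination (norm := module) (q ^ 2) • e3 + (2 * q * s) • e4 + (s ^ 2) • e5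

end System

/-! ### Reduction of skew-harmonicity to the real system -/

/-- Coordinatewise imaginary parts, a point of the cone for `p` in the upper half space. -/
noncomputable def imMap : ℂ × ℂ × ℂ →L[ℝ] ℝ × ℝ × ℝ :=
  imCLM.prodMap (imCLM.prodMap imCLM)

theorem imMap_apply (p : ℂ × ℂ × ℂ) : imMap p = (p.1.im, p.2.1.im, p.2.2.im) := rfl

theorem matY_eq_symMat (p : ℂ × ℂ × ℂ) : matY p = symMat (imMap p) := by
  ext i j
  fin_cases i <;> fin_cases j <;> simp [matY, matZ, symMat, imMap_apply]

theorem mem_siegel_iff {p : ℂ × ℂ × ℂ} : p ∈ siegelUpperHalfSpace ↔ imMap p ∈ posCone := by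
  rw [siegelUpperHalfSpace, Set.mem_ofPred_eq, matY_eq_symMat, posDef_symMat_iff]

theorem isOpen_siegel : IsOpen siegelUpperHalfSpace := by
  have : siegelUpperHalfSpace = imMap ⁻¹' posCone := by ext p; exact mem_siegel_iff
  rw [this]
  exact isOpen_posCone.preimage imMap.continuous

/-- The linear form `p ↦ tr(S X)`, with `S` the symmetric matrix with entries `s`. -/
noncomputable def traceForm (s : ℝ × ℝ × ℝ) : ℂ × ℂ × ℂ →L[ℝ] ℝ :=
  LinearMap.toContinuousLinearMap
    { toFun := fun p => s.1 * p.1.re + 2 * s.2.1 * p.2.1.re + s.2.2 * p.2.2.re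
      map_add' := fun u v => by simp; ring
      map_smul' := fun c v => by simp; ring }

theorem traceForm_apply (s : ℝ × ℝ × ℝ) (p : ℂ × ℂ × ℂ) :
    traceForm s p = s.1 * p.1.re + 2 * s.2.1 * p.2.1.re + s.2.2 * p.2.2.re := rfl

/-- The function `b(Y) exp(i tr(S X))`. -/
noncomputable def expMode (s : ℝ × ℝ × ℝ) (b : ℝ × ℝ × ℝ → ℂ) (p : ℂ × ℂ × ℂ) : ℂ :=
  b (imMap p) * cexp (I * (traceForm s p : ℂ))

theorem fderiv_expMode (s : ℝ × ℝ × ℝ) {b : ℝ × ℝ × ℝ → ℂ} {p : ℂ × ℂ × ℂ}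
    (hb : DifferentiableAt ℝ b (imMap p)) (e : ℂ × ℂ × ℂ) :
    fderiv ℝ (expMode s b) p e
      = (dirDeriv (imMap e) b (imMap p) + I * (traceForm s e : ℂ) * b (imMap p))
        * cexp (I * (traceForm s p : ℂ)) := by
  have h1 : HasFDerivAt (fun q => b (imMap q)) _ p := hb.hasFDerivAt.comp p imMap.hasFDerivAt
  have h2 : HasFDerivAt (fun q => I * (traceForm s q : ℂ)) _ p :=
    ((ofRealCLM.hasFDerivAt.comp p (traceForm s).hasFDerivAt).const_mul I)
  have h3 : HasFDerivAt (expMode s b) _ p := h1.mul h2.cexp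
  rw [h3.fderiv]
  simp [dirDeriv]
  ring

theorem wirtinger_expMode (s : ℝ × ℝ × ℝ) {b : ℝ × ℝ × ℝ → ℂ} {p : ℂ × ℂ × ℂ}
    (hb : DifferentiableAt ℝ b (imMap p)) (e : ℝ × ℝ × ℝ) (c : ℝ)
    (hc : s.1 * e.1 + 2 * s.2.1 * e.2.1 + s.2.2 * e.2.2 = c) :
    wirtinger ((e.1 : ℂ), (e.2.1 : ℂ), (e.2.2 : ℂ)) (expMode s b) p
      = expMode s (fun v => (I / 2) * (c * b v - dirDeriv e b v)) p := by
  rw [wirtinger, fderiv_expMode s hb, fderiv_expMode s hb]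
  have h1 : imMap ((e.1 : ℂ), (e.2.1 : ℂ), (e.2.2 : ℂ)) = 0 := by ext <;> simp [imMap_apply]
  have h2 : imMap (I • ((e.1 : ℂ), (e.2.1 : ℂ), (e.2.2 : ℂ))) = e := by
    ext <;> simp [imMap_apply]
  have h3 : traceForm s ((e.1 : ℂ), (e.2.1 : ℂ), (e.2.2 : ℂ)) = c := by
    simp [traceForm_apply, hc]
  have h4 : traceForm s (I • ((e.1 : ℂ), (e.2.1 : ℂ), (e.2.2 : ℂ))) = 0 := by
    simp [traceForm_apply]
  rw [h1, h2, h3, h4, expMode]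
  simp [dirDeriv]
  ring

theorem wirtingerBar_expMode (s : ℝ × ℝ × ℝ) {b : ℝ × ℝ × ℝ → ℂ} {p : ℂ × ℂ × ℂ}
    (hb : DifferentiableAt ℝ b (imMap p)) (e : ℝ × ℝ × ℝ) (c : ℝ)
    (hc : s.1 * e.1 + 2 * s.2.1 * e.2.1 + s.2.2 * e.2.2 = c) :
    wirtingerBar ((e.1 : ℂ), (e.2.1 : ℂ), (e.2.2 : ℂ)) (expMode s b) p
      = expMode s (fun v => (I / 2) * (c * b v + dirDeriv e b v)) p := by
  rw [wirtingerBar, fderiv_expMode s hb, fderiv_expMode s hb]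
  have h1 : imMap ((e.1 : ℂ), (e.2.1 : ℂ), (e.2.2 : ℂ)) = 0 := by ext <;> simp [imMap_apply]
  have h2 : imMap (I • ((e.1 : ℂ), (e.2.1 : ℂ), (e.2.2 : ℂ))) = e := by
    ext <;> simp [imMap_apply]
  have h3 : traceForm s ((e.1 : ℂ), (e.2.1 : ℂ), (e.2.2 : ℂ)) = c := by
    simp [traceForm_apply, hc]
  have h4 : traceForm s (I • ((e.1 : ℂ), (e.2.1 : ℂ), (e.2.2 : ℂ))) = 0 := by
    simp [traceForm_apply]
  rw [h1, h2, h3, h4, expMode]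
  simp [dirDeriv]
  ring


/-- The point `iY` of the upper half space. -/
noncomputable def imagPoint (v : ℝ × ℝ × ℝ) : ℂ × ℂ × ℂ :=
  (I * (v.1 : ℂ), I * (v.2.1 : ℂ), I * (v.2.2 : ℂ))

theorem imMap_imagPoint (v : ℝ × ℝ × ℝ) : imMap (imagPoint v) = v := by
  ext <;> simp [imMap_apply, imagPoint]

theorem expMode_imagPoint (s : ℝ × ℝ × ℝ) (b : ℝ × ℝ × ℝ → ℂ) (v : ℝ × ℝ × ℝ) :
    expMode s b (imagPoint v) = b v := by
  have : traceForm s (imagPoint v) = 0 := by simp [traceForm_apply, imagPoint]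
  rw [expMode, imMap_imagPoint, this]
  simp

theorem contDiffOn_of_expMode {s : ℝ × ℝ × ℝ} {b : ℝ × ℝ × ℝ → ℂ}
    (h : ContDiffOn ℝ ∞ (expMode s b) siegelUpperHalfSpace) : ContDiffOn ℝ ∞ b posCone := by
  have h1 : ContDiffOn ℝ ∞ (fun v => expMode s b (imagPoint v)) posCone := by
    refine h.comp (f := imagPoint) ?_ fun v hv => mem_siegel_iff.2 ?_
    · unfold imagPoint
      have : ∀ L : ℝ × ℝ × ℝ →L[ℝ] ℝ, ContDiff ℝ ∞ fun v => I * (L v : ℂ) := fun L =>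
        contDiff_const.mul (ofRealCLM.contDiff.comp L.contDiff)
      exact ((this (.fst ..)).prodMk ((this (.comp (.fst ..) (.snd ..))).prodMk
        (this (.comp (.snd ..) (.snd ..))))).contDiffOn
    · rwa [imMap_imagPoint]
  simpa only [expMode_imagPoint] using h1

section Entries

variable {s : ℝ × ℝ × ℝ} {b : ℝ × ℝ × ℝ → ℂ}

theorem wirtinger_congr {F G : ℂ × ℂ × ℂ → ℂ} (h : EqOn F G siegelUpperHalfSpace)
    (e : ℂ × ℂ × ℂ) : EqOn (wirtinger e F) (wirtinger e G) siegelUpperHalfSpace := by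
  intro p hp
  have : F =ᶠ[nhds p] G := h.eventuallyEq_of_mem (isOpen_siegel.mem_nhds hp)
  rw [wirtinger, wirtinger, this.fderiv_eq]

theorem wirtingerBar_congr {F G : ℂ × ℂ × ℂ → ℂ} (h : EqOn F G siegelUpperHalfSpace)
    (e : ℂ × ℂ × ℂ) : EqOn (wirtingerBar e F) (wirtingerBar e G) siegelUpperHalfSpace := by
  intro p hp
  have : F =ᶠ[nhds p] G := h.eventuallyEq_of_mem (isOpen_siegel.mem_nhds hp)
  rw [wirtingerBar, wirtingerBar, this.fderiv_eq]

/-- The operator on functions of `Y` through which an entry of `∂_Z` acts on `b(Y) exp(i tr(SX))`,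
up to the factor `i / 2`; here `c` is the corresponding entry of `S`, and `r` is `1` on the diagonal
and `1 / 2` off it. -/
noncomputable def loweringOp (c r : ℝ) (e : ℝ × ℝ × ℝ) (b : ℝ × ℝ × ℝ → ℂ) (v : ℝ × ℝ × ℝ) : ℂ :=
  (I / 2) * (c * b v - r * dirDeriv e b v)

theorem contDiffOn_loweringOp (hb : ContDiffOn ℝ ∞ b posCone) (c r : ℝ) (e : ℝ × ℝ × ℝ) :
    ContDiffOn ℝ ∞ (loweringOp c r e b) posCone :=
  contDiffOn_const.mul ((contDiffOn_const.mul hb).sub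
    (contDiffOn_const.mul (contDiffOn_dirDeriv hb e)))

theorem dirDeriv_loweringOp (hb : ContDiffOn ℝ ∞ b posCone) (c r : ℝ) (e e' : ℝ × ℝ × ℝ)
    {v : ℝ × ℝ × ℝ} (hv : v ∈ posCone) :
    dirDeriv e' (loweringOp c r e b) v
      = (I / 2) * (c * dirDeriv e' b v - r * dirDeriv e' (dirDeriv e b) v) := by
  have h1 := (differentiableAt_of_mem_posCone hb hv).hasFDerivAt
  have h2 := (differentiableAt_of_mem_posCone (contDiffOn_dirDeriv hb e) hv).hasFDerivAt
  have h3 : HasFDerivAt (loweringOp c r e b) _ v :=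
    ((h1.const_mul (c : ℂ)).sub (h2.const_mul (r : ℂ))).const_mul (I / 2)
  rw [dirDeriv, h3.fderiv]
  simp [dirDeriv]

theorem dZ_expMode (hb : ContDiffOn ℝ ∞ b posCone) {p : ℂ × ℂ × ℂ} (hp : p ∈ siegelUpperHalfSpace) :
    dZ (expMode s b) p = !![expMode s (loweringOp s.1 1 (1, 0, 0) b) p,
      expMode s (loweringOp s.2.1 (1 / 2) (0, 1, 0) b) p;
      expMode s (loweringOp s.2.1 (1 / 2) (0, 1, 0) b) p,
      expMode s (loweringOp s.2.2 1 (0, 0, 1) b) p] := by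
  have h := differentiableAt_of_mem_posCone hb (mem_siegel_iff.1 hp)
  have h1 := wirtinger_expMode s h (1, 0, 0) _ rfl
  have h2 := wirtinger_expMode s h (0, 1, 0) _ rfl
  have h3 := wirtinger_expMode s h (0, 0, 1) _ rfl
  push_cast at h1 h2 h3
  rw [dZ, h1, h2, h3]
  simp only [expMode, loweringOp]
  push_cast
  ext i j
  fin_cases i <;> fin_cases j <;> simp <;> ring

theorem dZbar_expMode_imagPoint (hb : ContDiffOn ℝ ∞ b posCone) {v : ℝ × ℝ × ℝ}
    (hv : v ∈ posCone) :
    dZbar (expMode s b) (imagPoint v) = !![(I / 2) * (s.1 * b v + pdX b v),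
      (I / 2) * (s.2.1 * b v + 1 / 2 * pdY b v); (I / 2) * (s.2.1 * b v + 1 / 2 * pdY b v),
      (I / 2) * (s.2.2 * b v + pdW b v)] := by
  have h : DifferentiableAt ℝ b (imMap (imagPoint v)) := by
    rw [imMap_imagPoint]; exact differentiableAt_of_mem_posCone hb hv
  have h1 := wirtingerBar_expMode s h (1, 0, 0) _ rfl
  have h2 := wirtingerBar_expMode s h (0, 1, 0) _ rfl
  have h3 := wirtingerBar_expMode s h (0, 0, 1) _ rfl
  push_cast at h1 h2 h3
  rw [dZbar, h1, h2, h3]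
  simp only [expMode_imagPoint]
  ext i j
  fin_cases i <;> fin_cases j <;> simp <;> ring

end Entries

/-- A function `b(Y) exp(i tr(S X))` is weight `k` skew-harmonic only if `b` solves the system. -/
theorem IsSkewHarmonic.isSkewSystem {k : ℤ} {s₁ s₂ s₃ : ℝ} {b : ℝ × ℝ × ℝ → ℂ}
    (hF : IsSkewHarmonic k (expMode (s₁, s₂, s₃) b)) : IsSkewSystem k s₁ s₂ s₃ b := by
  obtain ⟨hs, hF⟩ := hF
  have hb := contDiffOn_of_expMode hs
  have hH : ∀ v ∈ posCone, imagPoint v ∈ siegelUpperHalfSpace := fun v hv =>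
    mem_siegel_iff.2 (by rwa [imMap_imagPoint])
  have hbar : ∀ v ∈ posCone, ∀ (c r : ℝ) (e : ℝ × ℝ × ℝ) (G : ℂ × ℂ × ℂ → ℂ),
      EqOn G (expMode (s₁, s₂, s₃) (loweringOp c r e b)) siegelUpperHalfSpace →
      dZbar G (imagPoint v) = _ := fun v hv c r e G hG => by
    have h : dZbar G (imagPoint v) =
        dZbar (expMode (s₁, s₂, s₃) (loweringOp c r e b)) (imagPoint v) := by
      rw [dZbar, dZbar, wirtingerBar_congr hG _ (hH v hv), wirtingerBar_congr hG _ (hH v hv),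
        wirtingerBar_congr hG _ (hH v hv)]
    exact h.trans (dZbar_expMode_imagPoint (contDiffOn_loweringOp hb c r e) hv)
  have h00 : ∀ v ∈ posCone, _ := fun v hv => hbar v hv s₁ 1 (1, 0, 0)
    (fun q => dZ (expMode (s₁, s₂, s₃) b) q 0 0) fun q hq => by simp [dZ_expMode hb hq]
  have h01 : ∀ v ∈ posCone, _ := fun v hv => hbar v hv s₂ (1 / 2) (0, 1, 0)
    (fun q => dZ (expMode (s₁, s₂, s₃) b) q 0 1) fun q hq => by simp [dZ_expMode hb hq]
  have h10 : ∀ v ∈ posCone, _ := fun v hv => hbar v hv s₂ (1 / 2) (0, 1, 0)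
    (fun q => dZ (expMode (s₁, s₂, s₃) b) q 1 0) fun q hq => by simp [dZ_expMode hb hq]
  have h11 : ∀ v ∈ posCone, _ := fun v hv => hbar v hv s₃ 1 (0, 0, 1)
    (fun q => dZ (expMode (s₁, s₂, s₃) b) q 1 1) fun q hq => by simp [dZ_expMode hb hq]
  have hΩ : ∀ x y w, (x, y, w) ∈ posCone → ∀ i j, _ := fun x y w hv i j =>
    congrFun (congrFun (hF (imagPoint (x, y, w)) (hH _ hv)).1 i) j
  -- all entries of `Ω_k F` carry the factor `i²`, and `Y` is invertible
  have cancel : ∀ x y w : ℝ, (x, y, w) ∈ posCone → ∀ u v : ℂ,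
      I ^ 2 * ((x * w - y ^ 2) * (u - v)) = 0 → u = v := by
    intro x y w hv u v h
    have h1 : ((x : ℂ) * w - y ^ 2) ≠ 0 := by exact_mod_cast hv.2.ne'
    simpa [h1, sub_eq_zero] using h
  have hentry : ∀ x y w, (x, y, w) ∈ posCone → ∀ i j, _ := fun x y w hv i j => by
    have e := hΩ x y w hv i j
    simp only [skewOmega, secondOrderPart, Matrix.mul_apply, Fin.sum_univ_two, matY_eq_symMat,
      imMap_imagPoint, Matrix.add_apply, Matrix.sub_apply, Matrix.smul_apply, Matrix.of_apply,
      Matrix.map_apply, Matrix.zero_apply, dZ_expMode hb (hH _ hv), dZbar_expMode_imagPoint hb hv,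
      expMode_imagPoint] at e
    exact e
  have hcomm : ∀ x y w, (x, y, w) ∈ posCone → pdY (pdX b) (x, y, w) = pdX (pdY b) (x, y, w) ∧
      pdW (pdX b) (x, y, w) = pdX (pdW b) (x, y, w) ∧
      pdW (pdY b) (x, y, w) = pdY (pdW b) (x, y, w) := fun x y w hv =>
    ⟨dirDeriv_comm hb hv _ _, dirDeriv_comm hb hv _ _, dirDeriv_comm hb hv _ _⟩
  refine ⟨hb, ?_, ?_, ?_, ?_, ?_⟩ <;> intro x y w hv <;> obtain ⟨c1, c2, c3⟩ := hcomm x y w hv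
  · have hξ := (hF (imagPoint (x, y, w)) (hH _ hv)).2
    have hd : ∀ (c r : ℝ) e (G : ℂ × ℂ × ℂ → ℂ), EqOn G (expMode (s₁, s₂, s₃)
        (loweringOp c r e b)) siegelUpperHalfSpace → ∀ (e' : ℝ × ℝ × ℝ) (c' : ℝ),
        s₁ * e'.1 + 2 * s₂ * e'.2.1 + s₃ * e'.2.2 = c' →
        wirtinger ((e'.1 : ℂ), (e'.2.1 : ℂ), (e'.2.2 : ℂ)) G (imagPoint (x, y, w))
          = (I / 2) * (c' * loweringOp c r e b (x, y, w) - (I / 2) * (c * dirDeriv e' b (x, y, w)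
            - r * dirDeriv e' (dirDeriv e b) (x, y, w))) := by
      intro c r e G hG e' c' hc'
      have hdiff : DifferentiableAt ℝ (loweringOp c r e b) (imMap (imagPoint (x, y, w))) := by
        rw [imMap_imagPoint]
        exact differentiableAt_of_mem_posCone (contDiffOn_loweringOp hb c r e) hv
      rw [wirtinger_congr hG _ (hH _ hv), wirtinger_expMode (s₁, s₂, s₃) hdiff e' c' hc',
        expMode_imagPoint, dirDeriv_loweringOp hb _ _ _ _ hv]
    have hdiff : ∀ p ∈ siegelUpperHalfSpace, DifferentiableAt ℝ b (imMap p) := fun p hp =>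
      differentiableAt_of_mem_posCone hb (mem_siegel_iff.1 hp)
    have h1 := hd s₃ 1 (0, 0, 1) (wirtinger (0, 0, 1) (expMode (s₁, s₂, s₃) b))
      (fun p hp => by
        have h := wirtinger_expMode (s₁, s₂, s₃) (hdiff p hp) (0, 0, 1) s₃ (by simp)
        simpa only [expMode, loweringOp, ofReal_zero, ofReal_one, one_mul] using h)
      (1, 0, 0) s₁ (by simp)
    have h2 := hd (2 * s₂) 1 (0, 1, 0) (wirtinger (0, 1, 0) (expMode (s₁, s₂, s₃) b))
      (fun p hp => by
        have h := wirtinger_expMode (s₁, s₂, s₃) (hdiff p hp) (0, 1, 0) (2 * s₂) (by simp)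
        simpa only [expMode, loweringOp, ofReal_zero, ofReal_one, one_mul] using h)
      (0, 1, 0) (2 * s₂) (by simp)
    have hdet : (matZ (imagPoint (x, y, w))
        - (matZ (imagPoint (x, y, w))).map (starRingEnd ℂ)).det = -4 * (x * w - y ^ 2 : ℝ) := by
      rw [Matrix.det_fin_two]
      simp [matZ, imagPoint]
      linear_combination (4 * (x * w - y ^ 2 : ℂ)) * I_sq
    have hpow : ((((matY (imagPoint (x, y, w))).det ^ ((k : ℝ) - 3 / 2) : ℝ)) : ℂ) ≠ 0 := by
      rw [matY_eq_symMat, imMap_imagPoint, det_symMat]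
      exact_mod_cast (Real.rpow_pos_of_pos hv.2 _).ne'
    have hne : ((x * w - y ^ 2 : ℝ) : ℂ) ≠ 0 := by exact_mod_cast hv.2.ne'
    rw [skewXi, hdet, mul_eq_zero, or_iff_right (mul_ne_zero hpow (by simpa using hne))] at hξ
    simp only [loweringOp, ofReal_zero, ofReal_one] at h1 h2
    rw [h1, h2] at hξ
    push_cast at hξ
    simp only [Complex.real_smul]
    push_cast
    linear_combination (-4 : ℂ) * hξ + ((s₁ * s₃ - s₂ ^ 2) * b (x, y, w)
      - (s₁ * pdW b (x, y, w) + s₃ * pdX b (x, y, w) - s₂ * pdY b (x, y, w))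
      + pdX (pdW b) (x, y, w) - 1 / 4 * pdY (pdY b) (x, y, w)) * I_sq
  all_goals
    have e00 := hentry x y w hv 0 0
    have e01 := hentry x y w hv 0 1
    have e10 := hentry x y w hv 1 0
    have e11 := hentry x y w hv 1 1
    simp only [Fin.isValue, h00 _ hv, h01 _ hv, h10 _ hv, h11 _ hv, dirDeriv_loweringOp hb _ _ _ _ hv,
      symMat, of_apply, cons_val', cons_val_zero, cons_val_one, cons_val_fin_one, smul_eq_mul,
      loweringOp, c1, c2, c3] at e00 e01 e10 e11
    push_cast at e00 e01 e10 e11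
    apply cancel x y w hv
    simp only [Complex.real_smul]
    push_cast
  · linear_combination (1 / 2 : ℂ) * ((w * e01 - y * e11) - (x * e10 - y * e00))
  · linear_combination ((w : ℂ) * e00 - y * e10)
  · linear_combination (1 / 2 : ℂ) * ((w * e01 - y * e11) + (x * e10 - y * e00))
  · linear_combination ((x : ℂ) * e11 - y * e01)


/-! ### Fourier terms and their growth along rays -/

theorem fourierTerm_eq_expMode {T : Matrix (Fin 2) (Fin 2) ℝ} (hT : T.IsHermitian)
    (a : Matrix (Fin 2) (Fin 2) ℝ → ℂ) :
    fourierTerm T a = expMode (2 * Real.pi * T 0 0, 2 * Real.pi * T 0 1, 2 * Real.pi * T 1 1)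
      (fun v => a (symMat v)) := by
  funext p
  have h10 : T 1 0 = T 0 1 := by simpa using hT.apply 0 1
  rw [fourierTerm, expMode, matY_eq_symMat]
  congr 2
  simp [Matrix.trace_fin_two, Matrix.mul_apply, Fin.sum_univ_two, matX, matZ, traceForm_apply, h10]
  ring

/-- Polynomial growth of a function on the cone along every ray. -/
def HasRayGrowth {E : Type*} [NormedAddCommGroup E] [NormedSpace ℝ E]
    (b : ℝ × ℝ × ℝ → E) : Prop :=
  ∀ v ∈ posCone, ∃ r : ℝ, (fun t : ℝ => b (t • v)) =O[atTop] fun t : ℝ => t ^ r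

/-- Each ray through the cone eventually enters a region `Y ≥ ε`, on which moderate growth applies. -/
theorem HasModerateGrowth.hasRayGrowth {s : ℝ × ℝ × ℝ} {b : ℝ × ℝ × ℝ → ℂ}
    (h : HasModerateGrowth (expMode s b)) : HasRayGrowth b := by
  rintro ⟨x, y, w⟩ hv
  have hx := hv.1
  have hw := posCone_pos_right hv
  have hd := hv.2
  simp only at hx hw hd
  have hxw : 0 < x + w := by positivity
  -- this `ε` is a lower bound for both eigenvalues
  set ε : ℝ := (x * w - y ^ 2) / (x + w) with hε
  have hε0 : 0 < ε := by positivity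
  have hεm : ε * (x + w) = x * w - y ^ 2 := by rw [hε]; field_simp
  obtain ⟨r, hr⟩ := h ε hε0
  refine ⟨r, ?_⟩
  have htr : ∀ t : ℝ, (matY (imagPoint (t • (x, y, w)))).trace = t * (x + w) := fun t => by
    rw [matY_eq_symMat, imMap_imagPoint]
    simp [symMat, Matrix.trace_fin_two]
    ring
  have htend : Tendsto (fun t : ℝ => imagPoint (t • (x, y, w))) atTop
      (comap (fun p => (matY p).trace) atTop ⊓
        𝓟 {p | (matY p - ε • (1 : Matrix (Fin 2) (Fin 2) ℝ)).PosSemidef}) := by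
    refine tendsto_inf.2 ⟨tendsto_comap_iff.2 ?_, tendsto_principal.2 ?_⟩
    · refine Tendsto.congr (f₁ := fun t : ℝ => t * (x + w)) (fun t => (htr t).symm) ?_
      exact tendsto_id.atTop_mul_const hxw
    · filter_upwards [eventually_ge_atTop 1] with t ht
      have hεx : ε ≤ x := by
        rw [hε, div_le_iff₀ hxw]; nlinarith [sq_nonneg y]
      have hεw : ε ≤ w := by
        rw [hε, div_le_iff₀ hxw]; nlinarith [sq_nonneg y]
      have : matY (imagPoint (t • (x, y, w))) - ε • (1 : Matrix (Fin 2) (Fin 2) ℝ)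
          = symMat (t * x - ε, t * y, t * w - ε) := by
        rw [matY_eq_symMat, imMap_imagPoint]
        ext i j
        fin_cases i <;> fin_cases j <;> simp [symMat]
      rw [this]
      have hd' : 0 ≤ (t * x - ε) * (t * w - ε) - (t * y) ^ 2 := by
        have : (t * x - ε) * (t * w - ε) - (t * y) ^ 2 = t * (t - 1) * (x * w - y ^ 2) + ε ^ 2 := by
          linear_combination (-t) * hεm
        rw [this]
        have : 0 ≤ t * (t - 1) := mul_nonneg (by linarith) (by linarith)
        positivity
      exact symMat_posSemidef (by simp only; nlinarith) (by simp only; nlinarith) hd'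
  have h1 := hr.comp_tendsto htend
  have h2 : (fun t : ℝ => b (t • (x, y, w))) =O[atTop] fun t : ℝ => (t * (x + w)) ^ r := by
    refine h1.congr (fun t => ?_) (fun t => ?_)
    · simp only [Function.comp, expMode_imagPoint]
    · simp only [Function.comp, htr]
  refine h2.trans ?_
  refine IsBigO.of_bound ((x + w) ^ r) ?_
  filter_upwards [eventually_ge_atTop 0] with t ht
  rw [Real.mul_rpow ht hxw.le, norm_mul, mul_comm, Real.norm_of_nonneg (Real.rpow_nonneg hxw.le _)]

theorem HasRayGrowth.comp_congrMap {E : Type*} [NormedAddCommGroup E] [NormedSpace ℝ E]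
    {b : ℝ × ℝ × ℝ → E} (hb : HasRayGrowth b) {p q r s : ℝ} (hg : p * s - q * r ≠ 0) :
    HasRayGrowth (fun v => b (congrMap p q r s v)) := by
  intro v hv
  obtain ⟨c, hc⟩ := hb _ (mapsTo_congrMap hg hv)
  exact ⟨c, by simpa only [map_smul] using hc⟩

theorem HasRayGrowth.clm_comp {E G : Type*} [NormedAddCommGroup E] [NormedSpace ℝ E]
    [NormedAddCommGroup G] [NormedSpace ℝ G] {b : ℝ × ℝ × ℝ → E} (hb : HasRayGrowth b)
    (L : E →L[ℝ] G) : HasRayGrowth (fun v => L (b v)) := by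
  intro v hv
  obtain ⟨c, hc⟩ := hb v hv
  exact ⟨c, (L.isBigO_comp _ _).trans hc⟩

/-! ### The confluent hypergeometric integral -/

/-- A function on `(0, ∞)` with vanishing derivative is constant. -/
theorem eq_of_hasDerivAt_zero_Ioi {f : ℝ → ℝ} (hf : ∀ x, 0 < x → HasDerivAt f 0 x) {x y : ℝ}
    (hx : 0 < x) (hy : 0 < y) : f x = f y :=
  isOpen_Ioi.is_const_of_deriv_eq_zero isPreconnected_Ioi
    (fun z hz => (hf z hz).differentiableAt.differentiableWithinAt)
    (fun z hz => (hf z hz).deriv) hx hy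

/-- The integral `∫ e^(-xt) t^p (1 + t)^q dt` over `(0, ∞)`, a Gamma factor away from the confluent
hypergeometric function `U(p + 1, p + q + 2, x)`. -/
noncomputable def confluentIntegral (p q x : ℝ) : ℝ :=
  ∫ t in Ioi (0 : ℝ), Real.exp (-x * t) * t ^ p * (1 + t) ^ q

theorem one_add_rpow_le_exp (q : ℝ) {ε : ℝ} (hε : 0 < ε) :
    ∃ C, ∀ t, 0 ≤ t → (1 + t) ^ q ≤ C * Real.exp (ε * t) := by
  -- the base is compared with `e^(ct)` for a small slope `c`
  set c : ℝ := min 1 (ε / (|q| + 1)) with hc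
  have hq : 0 < |q| + 1 := by positivity
  have hc0 : 0 < c := lt_min one_pos (by positivity)
  have hc1 : c ≤ 1 := min_le_left _ _
  have hcq : c * |q| ≤ ε := by
    have : c * (|q| + 1) ≤ ε := by
      rw [← le_div_iff₀ hq]; exact min_le_right _ _
    nlinarith
  refine ⟨(1 / c) ^ |q|, fun t ht => ?_⟩
  have h1 : 1 + t ≤ (1 / c) * Real.exp (c * t) := by
    have := Real.add_one_le_exp (c * t)
    rw [one_div, ← div_eq_inv_mul, le_div_iff₀ hc0]
    nlinarith
  calc (1 + t) ^ q ≤ (1 + t) ^ |q| :=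
        Real.rpow_le_rpow_of_exponent_le (by linarith) (le_abs_self q)
    _ ≤ ((1 / c) * Real.exp (c * t)) ^ |q| :=
        Real.rpow_le_rpow (by linarith) h1 (abs_nonneg q)
    _ = (1 / c) ^ |q| * Real.exp (c * |q| * t) := by
        rw [Real.mul_rpow (by positivity) (Real.exp_pos _).le, ← Real.exp_mul]
        congr 2; ring
    _ ≤ (1 / c) ^ |q| * Real.exp (ε * t) := by gcongr

theorem integrableOn_confluent {p x : ℝ} (q : ℝ) (hp : -1 < p) (hx : 0 < x) :
    MeasureTheory.IntegrableOn (fun t : ℝ => Real.exp (-x * t) * t ^ p * (1 + t) ^ q)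
      (Ioi 0) := by
  obtain ⟨C, hC⟩ := one_add_rpow_le_exp q (half_pos hx)
  have h := (integrableOn_rpow_mul_exp_neg_mul_rpow hp one_pos (half_pos hx)).const_mul C
  refine h.mono' ?_ ?_
  · refine ContinuousOn.aestronglyMeasurable (fun t ht => ContinuousAt.continuousWithinAt ?_)
      measurableSet_Ioi
    have ht : 0 < t := ht
    have h1 : ContinuousAt (fun t : ℝ => t ^ p) t := Real.continuousAt_rpow_const _ _ (.inl ht.ne')
    have h2 : ContinuousAt (fun t : ℝ => (1 + t) ^ q) t :=
      ContinuousAt.rpow_const (by fun_prop) (.inl (by linarith))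
    exact ((by fun_prop : ContinuousAt (fun t : ℝ => Real.exp (-x * t)) t).mul h1).mul h2
  · refine (MeasureTheory.ae_restrict_iff' measurableSet_Ioi).2 (.of_forall fun t ht => ?_)
    have ht : 0 < t := ht
    have h1 : 0 ≤ (1 + t) ^ q := by positivity
    rw [Real.norm_of_nonneg (by positivity), Real.rpow_one]
    calc Real.exp (-x * t) * t ^ p * (1 + t) ^ q
        ≤ Real.exp (-x * t) * t ^ p * (C * Real.exp (x / 2 * t)) := by
          gcongr; exact hC t ht.le
      _ = C * (t ^ p * (Real.exp (-x * t) * Real.exp (x / 2 * t))) := by ring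
      _ = C * (t ^ p * Real.exp (-(x / 2) * t)) := by
          rw [← Real.exp_add]; congr 3; ring

theorem hasDerivAt_confluentIntegral {p x : ℝ} (q : ℝ) (hp : -1 < p) (hx : 0 < x) :
    HasDerivAt (confluentIntegral p q) (-confluentIntegral (p + 1) q x) x := by
  have hmeas : ∀ p' x' : ℝ, -1 < p' → 0 < x' → MeasureTheory.AEStronglyMeasurable
      (fun t : ℝ => Real.exp (-x' * t) * t ^ p' * (1 + t) ^ q)
      (MeasureTheory.volume.restrict (Ioi 0)) := fun p' x' hp' hx' =>
    (integrableOn_confluent q hp' hx').aestronglyMeasurable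
  have h := (hasDerivAt_integral_of_dominated_loc_of_deriv_le
    (μ := MeasureTheory.volume.restrict (Ioi (0 : ℝ)))
    (F := fun x t => Real.exp (-x * t) * t ^ p * (1 + t) ^ q)
    (F' := fun x t => -(Real.exp (-x * t) * t ^ (p + 1) * (1 + t) ^ q))
    (bound := fun t => Real.exp (-(x / 2) * t) * t ^ (p + 1) * (1 + t) ^ q)
    (Ioi_mem_nhds (half_lt_self hx)) ?_ (integrableOn_confluent q hp hx)
    (hmeas _ _ (by linarith) hx).neg ?_
    (integrableOn_confluent q (by linarith) (half_pos hx)) ?_).2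
  · rw [MeasureTheory.integral_neg] at h
    exact h
  · filter_upwards [Ioi_mem_nhds hx] with x' hx'
    exact hmeas _ _ hp hx'
  · refine (MeasureTheory.ae_restrict_iff' measurableSet_Ioi).2 (.of_forall fun t ht x' hx' => ?_)
    have ht : 0 < t := ht
    have hx' : x / 2 < x' := hx'
    have h1 : 0 ≤ (1 + t) ^ q := by positivity
    rw [norm_neg, Real.norm_of_nonneg (by positivity)]
    gcongr
  · refine (MeasureTheory.ae_restrict_iff' measurableSet_Ioi).2 (.of_forall fun t ht x' _ => ?_)
    have ht : 0 < t := ht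
    have h1 : HasDerivAt (fun x : ℝ => -x * t) (-1 * t) x' := (hasDerivAt_id x').neg.mul_const t
    refine ((h1.exp.mul_const (t ^ p)).mul_const ((1 + t) ^ q)).congr_deriv ?_
    rw [Real.rpow_add_one ht.ne']
    ring

theorem confluentIntegral_pos {p x : ℝ} (q : ℝ) (hp : -1 < p) (hx : 0 < x) :
    0 < confluentIntegral p q x := by
  refine (MeasureTheory.setIntegral_pos_iff_support_of_nonneg_ae ?_
    (integrableOn_confluent q hp hx)).2 ?_
  · refine (MeasureTheory.ae_restrict_iff' measurableSet_Ioi).2 (.of_forall fun t ht => ?_)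
    have ht : 0 < t := ht
    have h1 : 0 ≤ (1 + t) ^ q := by positivity
    simp only [Pi.zero_apply]
    positivity
  · have : Ioi (0 : ℝ) ⊆
        Function.support (fun t : ℝ => Real.exp (-x * t) * t ^ p * (1 + t) ^ q) ∩ Ioi 0 := by
      intro t ht
      have ht' : 0 < t := ht
      have : 0 < Real.exp (-x * t) * t ^ p * (1 + t) ^ q := by positivity
      exact ⟨this.ne', ht⟩
    exact lt_of_lt_of_le (by simp) (MeasureTheory.measure_mono this)

theorem confluentIntegral_anti {p x x' : ℝ} (q : ℝ) (hp : -1 < p) (hx : 0 < x) (h : x ≤ x') :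
    confluentIntegral p q x' ≤ confluentIntegral p q x := by
  refine MeasureTheory.setIntegral_mono_on (integrableOn_confluent q hp (hx.trans_le h))
    (integrableOn_confluent q hp hx) measurableSet_Ioi fun t ht => ?_
  have ht : 0 < t := ht
  have h1 : 0 ≤ (1 + t) ^ q := by positivity
  gcongr

/-- Kummer's equation, by integrating the derivative of `t^(1/2) (1 + t)^(k - 1/2) e^(-xt)`. -/
theorem confluentIntegral_kummer (k : ℝ) {x : ℝ} (hx : 0 < x) :
    x * confluentIntegral (3 / 2) (k - 3 / 2) x - (k - x) * confluentIntegral (1 / 2) (k - 3 / 2) x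
      - 1 / 2 * confluentIntegral (-1 / 2) (k - 3 / 2) x = 0 := by
  have i1 := integrableOn_confluent (p := 3 / 2) (k - 3 / 2) (by norm_num) hx
  have i2 := integrableOn_confluent (p := 1 / 2) (k - 3 / 2) (by norm_num) hx
  have i3 := integrableOn_confluent (p := -1 / 2) (k - 3 / 2) (by norm_num) hx
  have hint := ((i1.const_mul x).sub (i2.const_mul (k - x))).sub (i3.const_mul (1 / 2))
  have hderiv : ∀ t ∈ Ioi (0 : ℝ), HasDerivAt
      (fun t : ℝ => -(Real.exp (-x * t) * t ^ (1 / 2 : ℝ) * (1 + t) ^ (k - 1 / 2)))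
      (x * (Real.exp (-x * t) * t ^ (3 / 2 : ℝ) * (1 + t) ^ (k - 3 / 2))
        - (k - x) * (Real.exp (-x * t) * t ^ (1 / 2 : ℝ) * (1 + t) ^ (k - 3 / 2))
        - 1 / 2 * (Real.exp (-x * t) * t ^ (-1 / 2 : ℝ) * (1 + t) ^ (k - 3 / 2))) t := by
    intro t ht
    have ht : 0 < t := ht
    have h1 : HasDerivAt (fun t : ℝ => Real.exp (-x * t)) (Real.exp (-x * t) * (-x)) t := by
      simpa using ((hasDerivAt_id t).const_mul (-x)).exp
    have h2 : HasDerivAt (fun t : ℝ => t ^ (1 / 2 : ℝ)) (1 / 2 * t ^ (1 / 2 - 1 : ℝ)) t :=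
      Real.hasDerivAt_rpow_const (.inl ht.ne')
    have h3 : HasDerivAt (fun t : ℝ => (1 + t) ^ (k - 1 / 2))
        (1 * (k - 1 / 2) * (1 + t) ^ (k - 1 / 2 - 1)) t :=
      ((hasDerivAt_id t).const_add 1).rpow_const (.inl (by simp; linarith))
    refine ((h1.mul h2).mul h3).neg.congr_deriv ?_
    have e1 : t ^ (3 / 2 : ℝ) = t ^ (-1 / 2 : ℝ) * t ^ 2 := by
      rw [← Real.rpow_natCast, ← Real.rpow_add ht]; norm_num
    have e2 : t ^ (1 / 2 : ℝ) = t ^ (-1 / 2 : ℝ) * t := by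
      rw [← Real.rpow_add_one ht.ne']; norm_num
    have e3 : t ^ (1 / 2 - 1 : ℝ) = t ^ (-1 / 2 : ℝ) := by norm_num
    have e4 : (1 + t) ^ (k - 1 / 2) = (1 + t) ^ (k - 3 / 2) * (1 + t) := by
      rw [← Real.rpow_add_one (by linarith)]; congr 1; ring
    have e5 : (1 + t) ^ (k - 1 / 2 - 1) = (1 + t) ^ (k - 3 / 2) := by congr 1; ring
    simp only [Pi.mul_apply]
    rw [e1, e2, e3, e4, e5]
    ring
  have hcont : ContinuousWithinAt
      (fun t : ℝ => -(Real.exp (-x * t) * t ^ (1 / 2 : ℝ) * (1 + t) ^ (k - 1 / 2))) (Ici 0) 0 := by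
    refine ContinuousAt.continuousWithinAt (ContinuousAt.neg (ContinuousAt.mul
      (ContinuousAt.mul (by fun_prop) ?_) ?_))
    · exact Real.continuousAt_rpow_const _ _ (.inr (by norm_num))
    · exact ContinuousAt.rpow_const (by fun_prop) (.inl (by norm_num))
  have hlim : Tendsto
      (fun t : ℝ => -(Real.exp (-x * t) * t ^ (1 / 2 : ℝ) * (1 + t) ^ (k - 1 / 2))) atTop
      (nhds 0) := by
    obtain ⟨C, hC⟩ := one_add_rpow_le_exp (k - 1 / 2) (half_pos hx)
    have h1 : Tendsto (fun t : ℝ => C * (t ^ (1 / 2 : ℝ) * Real.exp (-(x / 2) * t))) atTop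
        (nhds 0) := by
      simpa using (tendsto_rpow_mul_exp_neg_mul_atTop_nhds_zero (1 / 2) (x / 2)
        (half_pos hx)).const_mul C
    have h2 : Tendsto (fun t : ℝ => Real.exp (-x * t) * t ^ (1 / 2 : ℝ) * (1 + t) ^ (k - 1 / 2))
        atTop (nhds 0) := by
      refine squeeze_zero' ?_ ?_ h1
      · filter_upwards [eventually_gt_atTop 0] with t ht
        have : 0 ≤ (1 + t) ^ (k - 1 / 2) := by positivity
        positivity
      · filter_upwards [eventually_gt_atTop 0] with t ht
        calc Real.exp (-x * t) * t ^ (1 / 2 : ℝ) * (1 + t) ^ (k - 1 / 2)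
            ≤ Real.exp (-x * t) * t ^ (1 / 2 : ℝ) * (C * Real.exp (x / 2 * t)) := by
              gcongr; exact hC t ht.le
          _ = C * (t ^ (1 / 2 : ℝ) * (Real.exp (-x * t) * Real.exp (x / 2 * t))) := by ring
          _ = C * (t ^ (1 / 2 : ℝ) * Real.exp (-(x / 2) * t)) := by
              rw [← Real.exp_add]; congr 3; ring
    simpa using h2.neg
  have h := MeasureTheory.integral_Ioi_of_hasDerivAt_of_tendsto hcont hderiv hint hlim
  have i12 : MeasureTheory.IntegrableOn (fun t : ℝ =>
      x * (Real.exp (-x * t) * t ^ (3 / 2 : ℝ) * (1 + t) ^ (k - 3 / 2))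
        - (k - x) * (Real.exp (-x * t) * t ^ (1 / 2 : ℝ) * (1 + t) ^ (k - 3 / 2))) (Ioi 0) :=
    (i1.const_mul x).sub (i2.const_mul (k - x))
  rw [MeasureTheory.integral_sub i12 (i3.const_mul (1 / 2)), MeasureTheory.integral_sub (i1.const_mul x) (i2.const_mul (k - x)),
    MeasureTheory.integral_const_mul, MeasureTheory.integral_const_mul,
    MeasureTheory.integral_const_mul] at h
  simpa [confluentIntegral] using h

/-! ### The radial equation for singular `T` -/

/-- The exponentially decaying solution of `s A'' + k A' = (s - k + 1) A`. -/
noncomputable def decayingSolution (k s : ℝ) : ℝ :=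
  Real.exp (-s) * confluentIntegral (-1 / 2) (k - 3 / 2) (2 * s)

/-- The derivative of the decaying solution. -/
noncomputable def decayingSolutionDeriv (k s : ℝ) : ℝ :=
  -(Real.exp (-s) * (confluentIntegral (-1 / 2) (k - 3 / 2) (2 * s)
    + 2 * confluentIntegral (1 / 2) (k - 3 / 2) (2 * s)))

theorem hasDerivAt_confluentIntegral_two_mul {p s : ℝ} (q : ℝ) (hp : -1 < p) (hs : 0 < s) :
    HasDerivAt (fun s => confluentIntegral p q (2 * s))
      (-confluentIntegral (p + 1) q (2 * s) * (2 * 1)) s :=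
  (hasDerivAt_confluentIntegral q hp (by linarith : 0 < 2 * s)).comp s
    ((hasDerivAt_id s).const_mul 2)

theorem hasDerivAt_exp_neg (s : ℝ) :
    HasDerivAt (fun s : ℝ => Real.exp (-s)) (Real.exp (-s) * (-1)) s :=
  (hasDerivAt_id s).neg.exp

theorem hasDerivAt_decayingSolution (k : ℝ) {s : ℝ} (hs : 0 < s) :
    HasDerivAt (decayingSolution k) (decayingSolutionDeriv k s) s := by
  have h := (hasDerivAt_exp_neg s).mul
    (hasDerivAt_confluentIntegral_two_mul (p := -1 / 2) (k - 3 / 2) (by norm_num) hs)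
  refine h.congr_deriv ?_
  rw [decayingSolutionDeriv, show (-1 / 2 + 1 : ℝ) = 1 / 2 by norm_num]
  ring

theorem hasDerivAt_decayingSolutionDeriv (k : ℝ) {s : ℝ} (hs : 0 < s) :
    HasDerivAt (decayingSolutionDeriv k)
      (((s - k + 1) * decayingSolution k s - k * decayingSolutionDeriv k s) / s) s := by
  have h1 := hasDerivAt_confluentIntegral_two_mul (p := -1 / 2) (k - 3 / 2) (by norm_num) hs
  have h2 := hasDerivAt_confluentIntegral_two_mul (p := 1 / 2) (k - 3 / 2) (by norm_num) hs
  rw [show (-1 / 2 + 1 : ℝ) = 1 / 2 by norm_num] at h1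
  rw [show (1 / 2 + 1 : ℝ) = 3 / 2 by norm_num] at h2
  refine ((hasDerivAt_exp_neg s).mul (h1.add (h2.const_mul 2))).neg.congr_deriv ?_
  have hk := confluentIntegral_kummer k (by linarith : 0 < 2 * s)
  rw [decayingSolution, decayingSolutionDeriv, eq_div_iff hs.ne']
  simp only [Pi.add_apply]
  linear_combination (2 * Real.exp (-s)) * hk

theorem decayingSolution_pos (k : ℝ) {s : ℝ} (hs : 0 < s) : 0 < decayingSolution k s :=
  mul_pos (Real.exp_pos _) (confluentIntegral_pos _ (by norm_num) (by linarith))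

theorem exists_decayingSolution_bound (k : ℝ) : ∃ C, 0 < C ∧ ∀ s, 1 ≤ s →
    decayingSolution k s ≤ C * Real.exp (-s) ∧
    |decayingSolutionDeriv k s| ≤ C * Real.exp (-s) := by
  have p1 := confluentIntegral_pos (p := -1 / 2) (x := 2) (k - 3 / 2) (by norm_num) (by norm_num)
  have p2 := confluentIntegral_pos (p := 1 / 2) (x := 2) (k - 3 / 2) (by norm_num) (by norm_num)
  refine ⟨confluentIntegral (-1 / 2) (k - 3 / 2) 2 + 2 * confluentIntegral (1 / 2) (k - 3 / 2) 2,
    by positivity, fun s hs => ?_⟩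
  have a1 := confluentIntegral_anti (p := -1 / 2) (x := 2) (x' := 2 * s) (k - 3 / 2) (by norm_num)
    (by norm_num) (by linarith)
  have a2 := confluentIntegral_anti (p := 1 / 2) (x := 2) (x' := 2 * s) (k - 3 / 2) (by norm_num)
    (by norm_num) (by linarith)
  have q1 := confluentIntegral_pos (p := -1 / 2) (x := 2 * s) (k - 3 / 2) (by norm_num)
    (by linarith)
  have q2 := confluentIntegral_pos (p := 1 / 2) (x := 2 * s) (k - 3 / 2) (by norm_num)
    (by linarith)
  constructor
  · rw [decayingSolution, mul_comm]
    gcongr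
    linarith
  · rw [decayingSolutionDeriv, abs_neg, abs_of_pos (by positivity), mul_comm]
    gcongr

/-- A function whose derivative is eventually at least `e^(s/2)` does not grow polynomially. -/
theorem not_isBigO_rpow_of_exp_le_deriv {A A' : ℝ → ℝ} {s₀ r : ℝ}
    (hA : ∀ s, s₀ ≤ s → HasDerivAt A (A' s) s) (h : ∀ s, s₀ ≤ s → Real.exp (s / 2) ≤ A' s) :
    ¬ A =O[atTop] fun s : ℝ => s ^ r := by
  intro hO
  have hE : ∀ s : ℝ, HasDerivAt (fun s : ℝ => 2 * Real.exp (s / 2)) (Real.exp (s / 2)) s := by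
    intro s
    refine ((((hasDerivAt_id s).div_const 2).exp).const_mul 2).congr_deriv ?_
    simp; ring
  have hmono : MonotoneOn (fun s => A s - 2 * Real.exp (s / 2)) (Ici s₀) := by
    refine monotoneOn_of_deriv_nonneg (convex_Ici s₀)
      (fun s hs => ((hA s hs).sub (hE s)).continuousAt.continuousWithinAt)
      (fun s hs => ?_) (fun s hs => ?_)
    · rw [interior_Ici] at hs
      exact ((hA s (le_of_lt hs)).sub (hE s)).differentiableAt.differentiableWithinAt
    · rw [interior_Ici] at hs
      have := ((hA s (le_of_lt hs)).sub (hE s)).deriv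
      rw [show (fun s => A s - 2 * Real.exp (s / 2)) = A - fun s => 2 * Real.exp (s / 2) from rfl,
        this]
      linarith [h s (le_of_lt hs)]
  have hexp : Tendsto (fun s : ℝ => Real.exp (s / 2)) atTop atTop :=
    Real.tendsto_exp_atTop.comp (tendsto_id.atTop_div_const two_pos)
  have h1 : (fun s : ℝ => Real.exp (s / 2)) =O[atTop] A := by
    refine IsBigO.of_bound 1 ?_
    filter_upwards [eventually_ge_atTop s₀,
      hexp.eventually_ge_atTop (-(A s₀ - 2 * Real.exp (s₀ / 2)))] with s hs hs2
    have := hmono (mem_Ici.2 le_rfl) hs hs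
    simp only at this
    have hpos := Real.exp_pos (s / 2)
    rw [Real.norm_of_nonneg hpos.le, Real.norm_of_nonneg (by linarith)]
    linarith
  have h2 : (fun s : ℝ => s ^ r) =o[atTop] fun s : ℝ => Real.exp (s / 2) := by
    refine (isLittleO_rpow_exp_pos_mul_atTop r (half_pos one_pos)).congr_right fun s => ?_
    congr 1; ring
  refine (isLittleO_irrefl' (f' := fun s : ℝ => Real.exp (s / 2)) ?_)
    ((h1.trans hO).trans_isLittleO h2)
  exact .of_forall fun s => by simp

/-- A polynomially bounded solution of `s A'' + k A' = (s - k + 1) A` is a multiple of the decaying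
one: otherwise the Wronskian `C s^(-k)` with the decaying solution forces `A'` to be exponentially
large. -/
theorem eq_mul_decayingSolution_of_growth {k : ℝ} {A A' : ℝ → ℝ}
    (hA : ∀ s, 0 < s → HasDerivAt A (A' s) s)
    (hA' : ∀ s, 0 < s → HasDerivAt A' (((s - k + 1) * A s - k * A' s) / s) s) {r : ℝ}
    (hO : A =O[atTop] fun s : ℝ => s ^ r) :
    ∃ c, ∀ s, 0 < s → A s = c * decayingSolution k s := by
  set w := decayingSolution k
  set w' := decayingSolutionDeriv k
  have hw : ∀ s, 0 < s → HasDerivAt w (w' s) s := fun s hs => hasDerivAt_decayingSolution k hs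
  have hW : ∀ s, 0 < s → HasDerivAt (fun s => s ^ k * (A' s * w s - A s * w' s)) 0 s := by
    intro s hs
    have h1 : HasDerivAt (fun s : ℝ => s ^ k) (k * s ^ (k - 1)) s :=
      Real.hasDerivAt_rpow_const (.inl hs.ne')
    refine (h1.mul (((hA' s hs).mul (hw s hs)).sub ((hA s hs).mul
      (hasDerivAt_decayingSolutionDeriv k hs)))).congr_deriv ?_
    have e : s ^ k = s ^ (k - 1) * s := by
      rw [← Real.rpow_add_one hs.ne']; congr 1; ring
    simp only [Pi.mul_apply, Pi.sub_apply]
    rw [e]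
    field_simp
    ring
  set C := (1 : ℝ) ^ k * (A' 1 * w 1 - A 1 * w' 1)
  have hC : ∀ s, 0 < s → s ^ k * (A' s * w s - A s * w' s) = C := fun s hs =>
    eq_of_hasDerivAt_zero_Ioi hW hs one_pos
  by_cases hC0 : C = 0
  · refine ⟨A 1 / w 1, fun s hs => ?_⟩
    have hq : ∀ s, 0 < s → HasDerivAt (fun s => A s / w s) 0 s := by
      intro s hs
      refine ((hA s hs).div (hw s hs) (decayingSolution_pos k hs).ne').congr_deriv ?_
      have := hC s hs
      rw [hC0, mul_eq_zero, or_iff_right (Real.rpow_pos_of_pos hs k).ne'] at this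
      rw [this, zero_div]
    have := eq_of_hasDerivAt_zero_Ioi hq hs one_pos
    rw [← this, div_mul_cancel₀ _ (decayingSolution_pos k hs).ne']
  · exfalso
    obtain ⟨D, hD0, hD⟩ := exists_decayingSolution_bound k
    -- after scaling by `C⁻¹` the Wronskian is `s^(-k)`
    have hO' : (fun s => C⁻¹ * A s) =O[atTop] fun s : ℝ => s ^ r := hO.const_mul_left _
    obtain ⟨M, hM0, hM⟩ := hO'.exists_pos
    have l1 : ∀ᶠ s : ℝ in atTop, 2 * D * s ^ k * Real.exp (s / 2) ≤ Real.exp s := by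
      have := (isLittleO_rpow_exp_pos_mul_atTop k (half_pos one_pos)).bound
        (inv_pos.2 (by positivity : 0 < 2 * D))
      filter_upwards [this, eventually_gt_atTop 0] with s hs hs0
      rw [Real.norm_of_nonneg (by positivity), Real.norm_of_nonneg (Real.exp_pos _).le,
        ← div_eq_inv_mul, le_div_iff₀ (by positivity)] at hs
      calc 2 * D * s ^ k * Real.exp (s / 2) = (s ^ k * (2 * D)) * Real.exp (s / 2) := by ring
        _ ≤ Real.exp (1 / 2 * s) * Real.exp (s / 2) := by gcongr
        _ = Real.exp s := by rw [← Real.exp_add]; congr 1; ring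
    have l2 : ∀ᶠ s : ℝ in atTop, 2 * (M * D) * (s ^ k * s ^ r) ≤ Real.exp s := by
      have := (isLittleO_rpow_exp_pos_mul_atTop (k + r) one_pos).bound
        (inv_pos.2 (by positivity : 0 < 2 * (M * D)))
      filter_upwards [this, eventually_gt_atTop 0] with s hs hs0
      rw [Real.norm_of_nonneg (by positivity), Real.norm_of_nonneg (Real.exp_pos _).le,
        ← div_eq_inv_mul, le_div_iff₀ (by positivity), one_mul, Real.rpow_add hs0] at hs
      linarith
    obtain ⟨s₀, hs₀⟩ := eventually_atTop.1 (((l1.and l2).and hM.bound).and (eventually_ge_atTop 1))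
    refine not_isBigO_rpow_of_exp_le_deriv (A' := fun s => C⁻¹ * A' s) (s₀ := s₀)
      (fun s hs => (hA s ?_).const_mul _) (fun s hs => ?_) hO'
    · linarith [(hs₀ s hs).2]
    · obtain ⟨⟨⟨e1, e2⟩, e3⟩, e4⟩ := hs₀ s hs
      have hs0 : 0 < s := by linarith
      obtain ⟨b1, b2⟩ := hD s e4
      have hsk := Real.rpow_pos_of_pos hs0 k
      have hsr := Real.rpow_pos_of_pos hs0 r
      have hwpos : 0 < w s := decayingSolution_pos k hs0
      have hWs : s ^ k * (C⁻¹ * A' s * w s) = 1 + s ^ k * (C⁻¹ * A s * w' s) := by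
        have := hC s hs0
        field_simp
        linarith
      rw [Real.norm_of_nonneg hsr.le] at e3
      have h1 : |C⁻¹ * A s * w' s| ≤ M * s ^ r * (D * Real.exp (-s)) := by
        rw [abs_mul]
        exact mul_le_mul e3 b2 (abs_nonneg _) (by positivity)
      have hee : Real.exp s * Real.exp (-s) = 1 := by rw [← Real.exp_add]; simp
      have hep := Real.exp_pos (-s)
      have h2 : s ^ k * (M * s ^ r * (D * Real.exp (-s))) ≤ 1 / 2 := by
        have := mul_le_mul_of_nonneg_right e2 hep.le
        rw [hee] at this
        linarith
      have h3 : s ^ k * (C⁻¹ * A s * w' s) ≥ -(1 / 2) := by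
        have := mul_le_mul_of_nonneg_left (neg_abs_le (C⁻¹ * A s * w' s)) hsk.le
        have h4 := mul_le_mul_of_nonneg_left h1 hsk.le
        linarith
      have h4 : 1 / 2 ≤ s ^ k * (C⁻¹ * A' s * w s) := by linarith
      have hA'pos : 0 < C⁻¹ * A' s := by
        have : 0 < s ^ k * (C⁻¹ * A' s * w s) := by linarith
        exact pos_of_mul_pos_left (pos_of_mul_pos_right this hsk.le) hwpos.le
      have h5 : 1 / 2 ≤ s ^ k * (C⁻¹ * A' s * (D * Real.exp (-s))) := by
        refine h4.trans ?_
        gcongr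
      have h6 : 2 * D * s ^ k * Real.exp (s / 2) * Real.exp (-s) ≤ 1 := by
        have := mul_le_mul_of_nonneg_right e1 hep.le
        rwa [hee] at this
      have h7 : 0 < D * s ^ k * Real.exp (-s) := by positivity
      refine le_of_mul_le_mul_left (a := D * s ^ k * Real.exp (-s)) ?_ h7
      linarith

/-- The derivative in `y` of the symmetry of `S Y ∂ b`, on diagonal matrices and for diagonal `S`. -/
theorem IsSkewSystem.symm_eq_deriv {k s₁ s₃ : ℝ} {b : ℝ × ℝ × ℝ → ℝ}
    (hb : IsSkewSystem k s₁ 0 s₃ b) {x w : ℝ} (hx : 0 < x) (hw : 0 < w) :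
    (s₁ * x - s₃ * w) / 2 * pdY (pdY b) (x, 0, w) + s₁ * pdW b (x, 0, w) - s₃ * pdX b (x, 0, w)
      = 0 := by
  have hv := posCone_diag hx hw
  have hc : ∀ c : ℝ, HasDerivAt (fun _ : ℝ => c) 0 0 := fun c => hasDerivAt_const 0 c
  have hY := hasDerivAt_comp_curve (contDiffOn_dirDeriv hb.smooth (0, 1, 0)) (hc x)
    (hasDerivAt_id (0 : ℝ)) (hc w) hv
  have hW := hasDerivAt_comp_curve (contDiffOn_dirDeriv hb.smooth (0, 0, 1)) (hc x)
    (hasDerivAt_id (0 : ℝ)) (hc w) hv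
  have hX := hasDerivAt_comp_curve (contDiffOn_dirDeriv hb.smooth (1, 0, 0)) (hc x)
    (hasDerivAt_id (0 : ℝ)) (hc w) hv
  have hid := hasDerivAt_id (0 : ℝ)
  have h := (((hY.const_mul ((s₁ * x - s₃ * w) / 2)).add ((hid.const_mul s₁).mul hW)).sub
    ((hid.const_mul s₃).mul hX))
  have hzero : (fun _ : ℝ => (0 : ℝ)) =ᶠ[nhds 0] fun y =>
      (s₁ * x - s₃ * w) / 2 * pdY b (x, y, w) + s₁ * y * pdW b (x, y, w)
        - s₃ * y * pdX b (x, y, w) := by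
    have hcont : Continuous fun y : ℝ => (x, y, w) := by fun_prop
    filter_upwards [hcont.continuousAt.preimage_mem_nhds (isOpen_posCone.mem_nhds hv)] with y hy
    have := hb.symm_eq x y w hy
    simp only [smul_eq_mul, zero_mul, add_zero, zero_add] at this
    exact this.symm
  have h0 := (HasDerivAt.congr_of_eventuallyEq h hzero).unique (hasDerivAt_const (0 : ℝ) (0 : ℝ))
  simp at h0
  linarith

section Singular

variable {k : ℝ} {b : ℝ × ℝ × ℝ → ℝ}

/-- For `S = diag(-1, 0)` a solution depends only on `x` and on the determinant. -/
theorem IsSkewSystem.eq_diag_of_singular (hb : IsSkewSystem k (-1) 0 0 b) {x y w : ℝ}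
    (hv : (x, y, w) ∈ posCone) : b (x, y, w) = b (x, 0, w - y ^ 2 / x) := by
  have hx : 0 < x := hv.1
  have hd : 0 < x * w - y ^ 2 := hv.2
  have hd' : 0 < w - y ^ 2 / x := by
    have : w - y ^ 2 / x = (x * w - y ^ 2) / x := by field_simp
    rw [this]; positivity
  have hcurve : ∀ t : ℝ, (x, t, w - y ^ 2 / x + t ^ 2 / x) ∈ posCone := fun t => by
    refine ⟨hx, ?_⟩
    have : x * (w - y ^ 2 / x + t ^ 2 / x) - t ^ 2 = x * w - y ^ 2 := by field_simp; ring
    simp only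
    rw [this]; exact hd
  have hder : ∀ t : ℝ, HasDerivAt (fun t => b (x, t, w - y ^ 2 / x + t ^ 2 / x)) 0 t := by
    intro t
    have h3 : HasDerivAt (fun t : ℝ => w - y ^ 2 / x + t ^ 2 / x) (2 * t / x) t := by
      simpa using (((hasDerivAt_id t).pow 2).div_const x).const_add (w - y ^ 2 / x)
    refine (hasDerivAt_comp_curve hb.smooth (hasDerivAt_const t x) (hasDerivAt_id t) h3
      (hcurve t)).congr_deriv ?_
    have := hb.symm_eq _ _ _ (hcurve t)
    simp only [smul_eq_mul, id] at this ⊢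
    generalize pdY b (x, t, w - y ^ 2 / x + t ^ 2 / x) = bY at this ⊢
    generalize pdW b (x, t, w - y ^ 2 / x + t ^ 2 / x) = bW at this ⊢
    field_simp
    linarith
  have := is_const_of_deriv_eq_zero (fun t => (hder t).differentiableAt) (fun t => (hder t).deriv)
    y 0
  simpa using this

/-- On diagonal matrices the symmetry of `S Y ∂ b` eliminates `b_yy` from the lower right entry of the
matrix equation, leaving an Euler equation in `w`. -/
theorem IsSkewSystem.pdW_pdW_of_singular (hb : IsSkewSystem k (-1) 0 0 b) {x w : ℝ} (hx : 0 < x)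
    (hw : 0 < w) : w * pdW (pdW b) (x, 0, w) + (k - 1 / 2) * pdW b (x, 0, w) = 0 := by
  have h1 := hb.symm_eq_deriv hx hw
  have h2 := hb.eq_WW _ _ _ (posCone_diag hx hw)
  simp only [smul_eq_mul] at h2
  linarith

theorem IsSkewSystem.pdX_pdW_of_singular (hb : IsSkewSystem k (-1) 0 0 b) {x w : ℝ} (hx : 0 < x)
    (hw : 0 < w) : pdX (pdW b) (x, 0, w) + (1 + 1 / (2 * x)) * pdW b (x, 0, w) = 0 := by
  have h1 := hb.symm_eq_deriv hx hw
  have h2 := hb.det_eq _ _ _ (posCone_diag hx hw)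
  simp only [smul_eq_mul] at h2
  field_simp
  linear_combination (2 * x) * h2 - h1

theorem IsSkewSystem.pdX_pdX_of_singular (hb : IsSkewSystem k (-1) 0 0 b) {x w : ℝ} (hx : 0 < x)
    (hw : 0 < w) : x * pdX (pdX b) (x, 0, w) - w / (2 * x) * pdW b (x, 0, w)
      + k * pdX b (x, 0, w) = (x - k + 1) * b (x, 0, w) := by
  have h1 := hb.symm_eq_deriv hx hw
  have h2 := hb.eq_XX _ _ _ (posCone_diag hx hw)
  simp only [smul_eq_mul] at h2
  field_simp
  linear_combination (2 * x) * h2 + w * h1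

theorem hasDerivAt_along_w {f : ℝ × ℝ × ℝ → ℝ} (hf : ContDiffOn ℝ ∞ f posCone) {x w : ℝ}
    (hx : 0 < x) (hw : 0 < w) : HasDerivAt (fun w => f (x, 0, w)) (pdW f (x, 0, w)) w := by
  refine (hasDerivAt_comp_curve hf (hasDerivAt_const w x) (hasDerivAt_const w 0) (hasDerivAt_id w)
    (posCone_diag hx hw)).congr_deriv (by simp)

theorem hasDerivAt_along_x {f : ℝ × ℝ × ℝ → ℝ} (hf : ContDiffOn ℝ ∞ f posCone) {x w : ℝ}
    (hx : 0 < x) (hw : 0 < w) : HasDerivAt (fun x => f (x, 0, w)) (pdX f (x, 0, w)) x := by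
  refine (hasDerivAt_comp_curve hf (hasDerivAt_id x) (hasDerivAt_const x 0) (hasDerivAt_const x w)
    (posCone_diag hx hw)).congr_deriv (by simp)

theorem hasDerivAt_rpow_mul_exp (c : ℝ) {x : ℝ} (hx : 0 < x) (ε : ℝ) :
    HasDerivAt (fun x : ℝ => x ^ c * Real.exp (ε * x))
      ((c / x + ε) * (x ^ c * Real.exp (ε * x))) x := by
  have h1 : HasDerivAt (fun x : ℝ => x ^ c) (c * x ^ (c - 1)) x :=
    Real.hasDerivAt_rpow_const (.inl hx.ne')
  refine (h1.mul ((hasDerivAt_id x).const_mul ε).exp).congr_deriv ?_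
  rw [Real.rpow_sub_one hx.ne']
  simp only [id]
  ring

/-- The derivative in `w` satisfies two first-order equations, hence is explicit. -/
theorem IsSkewSystem.exists_pdW_eq_of_singular (hb : IsSkewSystem k (-1) 0 0 b) :
    ∃ c, ∀ x w, 0 < x → 0 < w →
      pdW b (x, 0, w) = c * (x ^ (-1 / 2 : ℝ) * Real.exp (-1 * x)) * w ^ (1 / 2 - k) := by
  have hW := contDiffOn_dirDeriv hb.smooth (0, 0, 1)
  have h1 : ∀ x, 0 < x → ∀ w, 0 < w →
      HasDerivAt (fun w => w ^ (k - 1 / 2) * pdW b (x, 0, w)) 0 w := by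
    intro x hx w hw
    have hp : HasDerivAt (fun w : ℝ => w ^ (k - 1 / 2)) ((k - 1 / 2) * w ^ (k - 1 / 2 - 1)) w :=
      Real.hasDerivAt_rpow_const (.inl hw.ne')
    refine (hp.mul (hasDerivAt_along_w hW hx hw)).congr_deriv ?_
    rw [Real.rpow_sub_one hw.ne']
    have : pdW (pdW b) (x, 0, w) = -(k - 1 / 2) * pdW b (x, 0, w) / w := by
      rw [eq_div_iff hw.ne']
      linarith [hb.pdW_pdW_of_singular hx hw]
    rw [this]
    ring
  have h2 : ∀ x, 0 < x → HasDerivAt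
      (fun x => x ^ (1 / 2 : ℝ) * Real.exp (1 * x) * pdW b (x, 0, 1)) 0 x := by
    intro x hx
    refine ((hasDerivAt_rpow_mul_exp (1 / 2) hx 1).mul
      (hasDerivAt_along_x hW hx one_pos)).congr_deriv ?_
    have := hb.pdX_pdW_of_singular hx one_pos
    linear_combination (x ^ (1 / 2 : ℝ) * Real.exp (1 * x)) * this
  refine ⟨(1 : ℝ) ^ (1 / 2 : ℝ) * Real.exp (1 * 1) * pdW b (1, 0, 1), fun x w hx hw => ?_⟩
  have e1 : w ^ (k - 1 / 2) * pdW b (x, 0, w) = pdW b (x, 0, 1) := by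
    have := eq_of_hasDerivAt_zero_Ioi (h1 x hx) hw one_pos
    simpa using this
  have e2 := eq_of_hasDerivAt_zero_Ioi h2 hx one_pos
  rw [← e2, ← e1]
  have a1 : x ^ (-1 / 2 : ℝ) * x ^ (1 / 2 : ℝ) = 1 := by rw [← Real.rpow_add hx]; norm_num
  have a2 : w ^ (1 / 2 - k) * w ^ (k - 1 / 2) = 1 := by
    rw [← Real.rpow_add hw, show (1 / 2 - k + (k - 1 / 2) : ℝ) = 0 by ring, Real.rpow_zero]
  have a3 : Real.exp (1 * x) * Real.exp (-1 * x) = 1 := by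
    rw [← Real.exp_add]; simp
  calc pdW b (x, 0, w) = (x ^ (-1 / 2 : ℝ) * x ^ (1 / 2 : ℝ))
        * (w ^ (1 / 2 - k) * w ^ (k - 1 / 2)) * (Real.exp (1 * x) * Real.exp (-1 * x))
        * pdW b (x, 0, w) := by rw [a1, a2, a3]; ring
    _ = _ := by ring

/-- The solutions of ray growth for `S = diag(-1, 0)`. -/
theorem IsSkewSystem.eq_of_singular (hb : IsSkewSystem k (-1) 0 0 b) (hk : k ≠ 3 / 2)
    (hg : HasRayGrowth b) : ∃ c₁ c₂ : ℝ, ∀ x y w, (x, y, w) ∈ posCone →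
      b (x, y, w) = c₁ * ((x * w - y ^ 2) ^ (3 / 2 - k) * x ^ (k - 2) * Real.exp (-x))
        + c₂ * decayingSolution k x := by
  obtain ⟨c, hc⟩ := hb.exists_pdW_eq_of_singular
  have hk' : 3 / 2 - k ≠ 0 := fun h => hk (by linarith)
  set c₁ := c / (3 / 2 - k)
  have hcc : c₁ * (3 / 2 - k) = c := div_mul_cancel₀ _ hk'
  set q : ℝ → ℝ := fun x => x ^ (-1 / 2 : ℝ) * Real.exp (-1 * x)
  have hsplit : ∀ x w, 0 < x → 0 < w →
      b (x, 0, w) = c₁ * q x * w ^ (3 / 2 - k) + (b (x, 0, 1) - c₁ * q x) := by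
    intro x w hx hw
    have h : ∀ w, 0 < w → HasDerivAt (fun w => b (x, 0, w) - c₁ * q x * w ^ (3 / 2 - k)) 0 w := by
      intro w hw
      have hp : HasDerivAt (fun w : ℝ => w ^ (3 / 2 - k)) ((3 / 2 - k) * w ^ (3 / 2 - k - 1)) w :=
        Real.hasDerivAt_rpow_const (.inl hw.ne')
      refine ((hasDerivAt_along_w hb.smooth hx hw).sub
        (hp.const_mul (c₁ * q x))).congr_deriv ?_
      rw [hc x w hx hw, show (3 / 2 - k - 1 : ℝ) = 1 / 2 - k by ring]
      linear_combination (-q x * w ^ (1 / 2 - k)) * hcc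
    have := eq_of_hasDerivAt_zero_Ioi h hw one_pos
    simp only [Real.one_rpow] at this
    linarith
  -- the part that is independent of the determinant solves the ordinary equation
  set A : ℝ → ℝ := fun x => b (x, 0, 1) - c₁ * q x
  set A' : ℝ → ℝ := fun x => pdX b (x, 0, 1) - c₁ * ((-1 / 2 / x + -1) * q x)
  have hq : ∀ x, 0 < x → HasDerivAt q ((-1 / 2 / x + -1) * q x) x := fun x hx =>
    hasDerivAt_rpow_mul_exp (-1 / 2) hx (-1)
  have hA : ∀ x, 0 < x → HasDerivAt A (A' x) x := fun x hx =>
    (hasDerivAt_along_x hb.smooth hx one_pos).sub ((hq x hx).const_mul c₁)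
  have hA' : ∀ x, 0 < x → HasDerivAt A' (((x - k + 1) * A x - k * A' x) / x) x := by
    intro x hx
    have h1 : HasDerivAt (fun x : ℝ => -1 / 2 / x + -1) (1 / 2 / x ^ 2) x := by
      refine (((hasDerivAt_inv hx.ne').const_mul (-1 / 2)).add_const (-1)).congr_deriv ?_
      field_simp
    refine ((hasDerivAt_along_x (contDiffOn_dirDeriv hb.smooth (1, 0, 0)) hx one_pos).sub
      ((h1.mul (hq x hx)).const_mul c₁)).congr_deriv ?_
    have e1 := hb.pdX_pdX_of_singular hx one_pos
    have e2 := hc x 1 hx one_pos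
    rw [Real.one_rpow, mul_one] at e2
    change pdW b (x, 0, 1) = c * q x at e2
    rw [e2, ← hcc] at e1
    simp only [A, A']
    field_simp at e1 ⊢
    linear_combination e1
  obtain ⟨r, hr⟩ := hg (1, 0, 1) (posCone_diag one_pos one_pos)
  have hAO : A =O[atTop] fun x : ℝ => x ^ max r 0 := by
    have h1 : (fun x : ℝ => b (x • (1, 0, 1))) =O[atTop] fun x : ℝ => x ^ max r 0 := by
      refine hr.trans (IsBigO.of_bound 1 ?_)
      filter_upwards [eventually_ge_atTop 1] with x hx
      rw [one_mul, Real.norm_of_nonneg (by positivity), Real.norm_of_nonneg (by positivity)]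
      exact Real.rpow_le_rpow_of_exponent_le hx (le_max_left _ _)
    have h2 : (fun x : ℝ => q x * x ^ (3 / 2 - k)) =O[atTop] fun x : ℝ => x ^ max r 0 := by
      have h3 : (fun x : ℝ => q x * x ^ (3 / 2 - k)) =O[atTop] fun _ : ℝ => (1 : ℝ) := by
        have ht := tendsto_rpow_mul_exp_neg_mul_atTop_nhds_zero (1 - k) 1 one_pos
        refine (ht.isBigO_one ℝ).congr' ?_ .rfl
        filter_upwards [eventually_gt_atTop 0] with x hx
        rw [show (1 - k : ℝ) = -1 / 2 + (3 / 2 - k) by ring, Real.rpow_add hx]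
        simp only [q]
        ring
      refine h3.trans (IsBigO.of_bound 1 ?_)
      filter_upwards [eventually_ge_atTop 1] with x hx
      rw [one_mul, norm_one, Real.norm_of_nonneg (by positivity)]
      exact Real.one_le_rpow hx (le_max_right _ _)
    refine (h1.sub (h2.const_mul_left c₁)).congr' ?_ .rfl
    filter_upwards [eventually_gt_atTop 0] with x hx
    have := hsplit x x hx hx
    simp only [Prod.smul_mk, smul_eq_mul, mul_one, mul_zero]
    rw [this]
    ring
  obtain ⟨c₂, hc₂⟩ := eq_mul_decayingSolution_of_growth hA hA' hAO
  refine ⟨c₁, c₂, fun x y w hv => ?_⟩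
  have hx : 0 < x := hv.1
  have hd : 0 < x * w - y ^ 2 := hv.2
  have hdx : w - y ^ 2 / x = (x * w - y ^ 2) * x⁻¹ := by field_simp
  rw [hb.eq_diag_of_singular hv, hdx, hsplit x _ hx (by positivity),
    show b (x, 0, 1) - c₁ * q x = A x from rfl, hc₂ x hx,
    Real.mul_rpow hd.le (by positivity), Real.inv_rpow hx.le, ← Real.rpow_neg hx.le]
  have : x ^ (k - 2) = x ^ (-1 / 2 : ℝ) * x ^ (-(3 / 2 - k)) := by
    rw [← Real.rpow_add hx]; congr 1; ring
  rw [this]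
  simp only [q, neg_one_mul]
  ring

end Singular

/-! ### An ordinary differential system transversal to the scalar matrices -/

theorem monotoneOn_Icc_of_hasDerivAt {f f' : ℝ → ℝ} {a c : ℝ}
    (hf : ∀ x ∈ Icc a c, HasDerivAt f (f' x) x) (h : ∀ x ∈ Ioo a c, 0 ≤ f' x) :
    MonotoneOn f (Icc a c) := by
  refine monotoneOn_of_deriv_nonneg (convex_Icc a c)
    (fun x hx => (hf x hx).continuousAt.continuousWithinAt) (fun x hx => ?_) (fun x hx => ?_)
  · rw [interior_Icc] at hx
    exact (hf x (Ioo_subset_Icc_self hx)).differentiableAt.differentiableWithinAt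
  · rw [interior_Icc] at hx
    rw [(hf x (Ioo_subset_Icc_self hx)).deriv]
    exact h x hx

/-- A continuous function stays positive if it cannot vanish for the first time. -/
theorem pos_of_no_first_zero {m : ℝ → ℝ} {a : ℝ} (hm : ContinuousOn m (Ici a)) (ha : 0 < m a)
    (h : ∀ c, a < c → (∀ x ∈ Ico a c, 0 < m x) → 0 < m c) : ∀ x, a ≤ x → 0 < m x := by
  intro x hx
  by_contra hneg
  have hS : IsCompact (Icc a x ∩ m ⁻¹' Iic 0) :=
    isCompact_Icc.of_isClosed_subset ((hm.mono Icc_subset_Ici_self).preimage_isClosed_of_isClosed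
      isClosed_Icc isClosed_Iic) inter_subset_left
  obtain ⟨c, ⟨hc1, hc2⟩, hcmin⟩ := hS.exists_isLeast ⟨x, ⟨hx, le_rfl⟩, not_lt.1 hneg⟩
  have hac : a < c := lt_of_le_of_ne hc1.1 fun e => by
    rw [← e] at hc2; exact absurd ha (not_lt.2 hc2)
  refine absurd (h c hac fun y hy => ?_) (not_lt.2 hc2)
  by_contra hy0
  exact absurd (hcmin ⟨⟨hy.1, hy.2.le.trans hc1.2⟩, not_lt.1 hy0⟩) (not_le.2 hy.2)

/-- The ordinary differential system satisfied by `ψ(x) = e^x b(x, 0, t)` and by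
`φ₁ = e^x (b_x + b)`, `φ₂ = e^x (b_w + b)` for a solution `b` with `S = -1`; `κ` is the
derivative of `φ₂`. The system is singular at `x = t`. -/
structure IsRadialSystem (k t : ℝ) (ψ φ₁ φ₂ κ : ℝ → ℝ) : Prop where
  deriv_psi : ∀ x, 0 < x → HasDerivAt ψ (φ₁ x) x
  deriv_one : ∀ x, 0 < x → HasDerivAt φ₁ (((2 * x - k) * φ₁ x + ψ x - t * κ x) / x) x
  deriv_two : ∀ x, 0 < x → HasDerivAt φ₂ (κ x) x
  rel : ∀ x, 0 < x → (x - t) * κ x = (φ₁ x - φ₂ x) / 2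

namespace IsRadialSystem

variable {k t : ℝ} {ψ φ₁ φ₂ κ : ℝ → ℝ}

/-- The factor `(x - t) e^(-2x) x^(k - 1/2)` integrates the equation of `φ₁ - φ₂` and removes its
singularity. -/
theorem hasDerivAt_scaled_sub (h : IsRadialSystem k t ψ φ₁ φ₂ κ) {x : ℝ} (hx : 0 < x) :
    HasDerivAt (fun x => x ^ (k - 1 / 2) * Real.exp (-2 * x) * ((x - t) * (φ₁ x - φ₂ x)))
      (x ^ (k - 1 / 2) * Real.exp (-2 * x) * ((x - t) * (((2 * x - k) * φ₂ x + ψ x) / x))) x := by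
  refine ((hasDerivAt_rpow_mul_exp (k - 1 / 2) hx (-2)).mul (((hasDerivAt_id x).sub_const t).mul
    ((h.deriv_one x hx).sub (h.deriv_two x hx)))).congr_deriv ?_
  have := h.rel x hx
  simp only [Pi.mul_apply, Pi.sub_apply, id]
  field_simp
  linear_combination (-2 * (x + t)) * this

theorem continuousOn (h : IsRadialSystem k t ψ φ₁ φ₂ κ) (ht : 0 < t) :
    ContinuousOn ψ (Ici t) ∧ ContinuousOn φ₂ (Ici t) :=
  ⟨fun x hx => (h.deriv_psi x (ht.trans_le hx)).continuousAt.continuousWithinAt,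
    fun x hx => (h.deriv_two x (ht.trans_le hx)).continuousAt.continuousWithinAt⟩

/-- As long as `ψ` and `φ₂` are positive, `φ₁ - φ₂` is nonnegative. -/
theorem sub_nonneg_of_pos (h : IsRadialSystem k t ψ φ₁ φ₂ κ) (ht : 0 < t) (hk : k ≤ t) {c : ℝ}
    (hpos : ∀ x ∈ Ico t c, 0 < ψ x ∧ 0 < φ₂ x) {x : ℝ} (hx : x ∈ Ioc t c) : 0 ≤ φ₁ x - φ₂ x := by
  have hmono := monotoneOn_Icc_of_hasDerivAt (a := t) (c := c)
    (fun y hy => h.hasDerivAt_scaled_sub (ht.trans_le hy.1)) (fun y hy => by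
      obtain ⟨p1, p2⟩ := hpos y (Ioo_subset_Ico_self hy)
      have hy0 : 0 < y := ht.trans hy.1
      have h1 : 0 ≤ y - t := by linarith [hy.1]
      have h2 : 0 ≤ 2 * y - k := by linarith [hy.1]
      positivity)
  have := hmono ⟨le_rfl, hx.1.le.trans hx.2⟩ ⟨hx.1.le, hx.2⟩ hx.1.le
  simp only [sub_self, zero_mul, mul_zero] at this
  have hx0 : 0 < x := ht.trans hx.1
  have h1 : 0 < x ^ (k - 1 / 2) * Real.exp (-2 * x) := by positivity
  have h2 : 0 < x - t := by linarith [hx.1]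
  exact nonneg_of_mul_nonneg_right (nonneg_of_mul_nonneg_right this h1) h2

/-- Monotonicity on an initial interval of positivity. -/
theorem monotoneOn_of_pos (h : IsRadialSystem k t ψ φ₁ φ₂ κ) (ht : 0 < t) (hk : k ≤ t) {c : ℝ}
    (hpos : ∀ x ∈ Ico t c, 0 < ψ x ∧ 0 < φ₂ x) :
    MonotoneOn ψ (Icc t c) ∧ MonotoneOn φ₂ (Icc t c) := by
  constructor
  · refine monotoneOn_Icc_of_hasDerivAt (fun x hx => h.deriv_psi x (ht.trans_le hx.1)) ?_
    intro x hx
    have h1 := h.sub_nonneg_of_pos ht hk hpos ⟨hx.1, hx.2.le⟩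
    have h2 := (hpos x (Ioo_subset_Ico_self hx)).2
    linarith
  · refine monotoneOn_Icc_of_hasDerivAt (fun x hx => h.deriv_two x (ht.trans_le hx.1)) ?_
    intro x hx
    have h1 := h.sub_nonneg_of_pos ht hk hpos ⟨hx.1, hx.2.le⟩
    have h2 := h.rel x (ht.trans hx.1)
    have h3 : 0 < x - t := by linarith [hx.1]
    exact nonneg_of_mul_nonneg_right (by rw [h2]; linarith) h3

theorem pos_of_initial_pos (h : IsRadialSystem k t ψ φ₁ φ₂ κ) (ht : 0 < t) (hk : k ≤ t)
    (hψ : 0 < ψ t) (hφ : 0 < φ₂ t) : ∀ x, t ≤ x → 0 < ψ x ∧ 0 < φ₂ x := by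
  have hc := h.continuousOn ht
  have := pos_of_no_first_zero (m := fun x => min (ψ x) (φ₂ x)) (hc.1.inf hc.2)
    (lt_min hψ hφ) (fun c hc hpos => by
      obtain ⟨m1, m2⟩ := h.monotoneOn_of_pos ht hk (c := c) fun x hx => lt_min_iff.1 (hpos x hx)
      have a1 : t ∈ Icc t c := ⟨le_rfl, hc.le⟩
      have a2 : c ∈ Icc t c := ⟨hc.le, le_rfl⟩
      exact lt_min (hψ.trans_le (m1 a1 a2 hc.le)) (hφ.trans_le (m2 a1 a2 hc.le)))
  exact fun x hx => lt_min_iff.1 (this x hx)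

/-- Positive initial values at `x = t` force `ψ(3t)` to be of size `e^(4t) φ₂(t) / t`. -/
theorem lower_bound (h : IsRadialSystem k t ψ φ₁ φ₂ κ) (ht : 1 ≤ t) (hk : k ≤ t) (hk1 : 1 ≤ k)
    (hψ : 0 < ψ t) (hφ : 0 < φ₂ t) :
    (1 / 4) * 3 ^ (1 / 2 - k) * Real.exp (-4) * (φ₂ t * Real.exp (4 * t) / t) ≤ ψ (3 * t) := by
  have ht0 : 0 < t := by linarith
  have hpos := h.pos_of_initial_pos ht0 hk hψ hφ
  have hφmono : ∀ x, t ≤ x → φ₂ t ≤ φ₂ x := fun x hx =>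
    (h.monotoneOn_of_pos ht0 hk (c := x) fun y hy => hpos y hy.1).2 ⟨le_rfl, hx⟩ ⟨hx, le_rfl⟩ hx
  have hsub : ∀ x, t < x → 0 ≤ φ₁ x - φ₂ x := fun x hx =>
    h.sub_nonneg_of_pos ht0 hk (c := x) (fun y hy => hpos y hy.1) ⟨hx, le_rfl⟩
  set D : ℝ → ℝ := fun x => x ^ (k - 1 / 2) * Real.exp (-2 * x) * ((x - t) * (φ₁ x - φ₂ x))
  set E : ℝ := t ^ (k - 1 / 2) * Real.exp (-2 * (t + 1)) * φ₂ t
  have hE : 0 < E := by positivity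
  -- the scaled difference picks up a definite amount on `[t, t + 1]`
  have hD1 : E / 2 ≤ D (t + 1) := by
    have hq : ∀ x : ℝ, HasDerivAt (fun x => E * ((x - t) ^ 2 / 2)) (E * (x - t)) x := fun x => by
      refine (((((hasDerivAt_id x).sub_const t).pow 2).div_const 2).const_mul E).congr_deriv ?_
      simp
    have hm := monotoneOn_Icc_of_hasDerivAt (a := t) (c := t + 1)
      (fun x hx => (h.hasDerivAt_scaled_sub (ht0.trans_le hx.1)).sub (hq x)) (fun x hx => by
        have hx0 : 0 < x := ht0.trans hx.1
        have hxt : 0 ≤ x - t := by linarith [hx.1]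
        have e1 : t ^ (k - 1 / 2) ≤ x ^ (k - 1 / 2) :=
          Real.rpow_le_rpow ht0.le hx.1.le (by linarith)
        have e2 : Real.exp (-2 * (t + 1)) ≤ Real.exp (-2 * x) :=
          Real.exp_le_exp.2 (by linarith [hx.2])
        have e3 : φ₂ t ≤ ((2 * x - k) * φ₂ x + ψ x) / x := by
          rw [le_div_iff₀ hx0]
          have p := hpos x hx.1.le
          have p2 := hφmono x hx.1.le
          nlinarith [hx.1, mul_nonneg (by linarith [hx.1] : 0 ≤ x - k) p.2.le]
        have e4 : E ≤ x ^ (k - 1 / 2) * Real.exp (-2 * x) * (((2 * x - k) * φ₂ x + ψ x) / x) := by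
          have : 0 ≤ ((2 * x - k) * φ₂ x + ψ x) / x := hφ.le.trans e3
          simp only [E]
          gcongr
        have := mul_le_mul_of_nonneg_right e4 hxt
        linarith)
    have := hm ⟨le_rfl, by linarith⟩ ⟨by linarith, le_rfl⟩ (by linarith : t ≤ t + 1)
    simp only [Pi.sub_apply, sub_self, zero_mul, mul_zero, add_sub_cancel_left] at this
    simp only [D, add_sub_cancel_left]
    norm_num at this ⊢
    linarith
  have hDx : ∀ x, t + 1 ≤ x → E / 2 ≤ D x := fun x hx => by
    have hm := monotoneOn_Icc_of_hasDerivAt (a := t + 1) (c := x)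
      (fun y hy => h.hasDerivAt_scaled_sub (by linarith [hy.1])) (fun y hy => by
        have hyt : t ≤ y := by linarith [hy.1]
        obtain ⟨p1, p2⟩ := hpos y hyt
        have hy0 : 0 < y := ht0.trans_le hyt
        have h1 : 0 ≤ y - t := by linarith
        have h2 : 0 ≤ 2 * y - k := by linarith
        positivity)
    exact hD1.trans (hm ⟨le_rfl, hx⟩ ⟨hx, le_rfl⟩ hx)
  set G : ℝ := (1 / 4) * 3 ^ (1 / 2 - k) * Real.exp (-4) * (φ₂ t * Real.exp (4 * t) / t)
  have hG : ∀ x ∈ Ioo (3 * t - 1) (3 * t), G ≤ φ₁ x := by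
    intro x hx
    have hxt : t + 1 ≤ x := by linarith [hx.1]
    have hx0 : 0 < x := by linarith
    have hs := hsub x (by linarith)
    have hle : D x ≤ (3 * t) ^ (k - 1 / 2) * Real.exp (-2 * (3 * t - 1))
        * ((2 * t) * (φ₁ x - φ₂ x)) := by
      have e1 : x ^ (k - 1 / 2) ≤ (3 * t) ^ (k - 1 / 2) :=
        Real.rpow_le_rpow hx0.le hx.2.le (by linarith)
      have e2 : Real.exp (-2 * x) ≤ Real.exp (-2 * (3 * t - 1)) :=
        Real.exp_le_exp.2 (by linarith [hx.1])
      have e3 : x - t ≤ 2 * t := by linarith [hx.2]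
      have e4 : 0 ≤ x - t := by linarith
      simp only [D]
      gcongr
    have h1 := (hDx x hxt).trans hle
    have e1 : (3 * t) ^ (k - 1 / 2) = 3 ^ (k - 1 / 2) * t ^ (k - 1 / 2) :=
      Real.mul_rpow (by norm_num) ht0.le
    have e2 : (3 : ℝ) ^ (1 / 2 - k) * 3 ^ (k - 1 / 2) = 1 := by
      rw [← Real.rpow_add (by norm_num)]; simp
    have e3 : Real.exp (-2 * (t + 1)) = Real.exp (-2 * (3 * t - 1))
        * (Real.exp (-4) * Real.exp (4 * t)) := by
      rw [← Real.exp_add, ← Real.exp_add]; congr 1; ring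
    have h2 : G ≤ φ₁ x - φ₂ x := by
      have hp : 0 < 3 ^ (k - 1 / 2) * t ^ (k - 1 / 2) * Real.exp (-2 * (3 * t - 1)) * (2 * t) := by
        positivity
      refine le_of_mul_le_mul_left (a := 3 ^ (k - 1 / 2) * t ^ (k - 1 / 2)
        * Real.exp (-2 * (3 * t - 1)) * (2 * t)) ?_ hp
      calc 3 ^ (k - 1 / 2) * t ^ (k - 1 / 2) * Real.exp (-2 * (3 * t - 1)) * (2 * t) * G
          = ((3 : ℝ) ^ (1 / 2 - k) * 3 ^ (k - 1 / 2)) * (t ^ (k - 1 / 2)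
            * (Real.exp (-2 * (3 * t - 1)) * (Real.exp (-4) * Real.exp (4 * t))) * φ₂ t) / 2 := by
            simp only [G]; field_simp; ring
        _ = E / 2 := by rw [e2, ← e3, one_mul]
        _ ≤ _ := h1
        _ = _ := by rw [e1]; ring
    linarith [(hpos x (by linarith)).2]
  have hm := monotoneOn_Icc_of_hasDerivAt (a := 3 * t - 1) (c := 3 * t)
    (fun x hx => (h.deriv_psi x (by linarith [hx.1])).sub ((hasDerivAt_id x).const_mul G))
    (fun x hx => by linarith [hG x hx])
  have := hm ⟨le_rfl, by linarith⟩ ⟨by linarith, le_rfl⟩ (by linarith : 3 * t - 1 ≤ 3 * t)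
  simp only [Pi.sub_apply, id] at this
  have h3 := (hpos (3 * t - 1) (by linarith)).1
  linarith

/-- Vanishing initial values at the singular point `x = t` force `ψ = 0`, by Gronwall's argument
for `ψ² + (x φ₁ + t φ₂)² + (φ₁ - φ₂)²`: the singular term has the favourable sign. -/
theorem eq_zero_of_initial_zero (h : IsRadialSystem k t ψ φ₁ φ₂ κ) (ht : 0 < t)
    (hψ : ψ t = 0) (hφ₁ : φ₁ t = 0) (hφ₂ : φ₂ t = 0) {X : ℝ} (hX : t ≤ X) : ψ X = 0 := by
  set g : ℝ → ℝ := fun x => x * φ₁ x + t * φ₂ x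
  set δ : ℝ → ℝ := fun x => φ₁ x - φ₂ x
  have dg : ∀ x, 0 < x → HasDerivAt g ((2 * x - k + 1) * φ₁ x + ψ x) x := fun x hx => by
    refine (((hasDerivAt_id x).mul (h.deriv_one x hx)).add
      ((h.deriv_two x hx).const_mul t)).congr_deriv ?_
    simp only [id]
    field_simp
    ring
  have dδ : ∀ x, 0 < x → HasDerivAt δ (((2 * x - k) * φ₁ x + ψ x) / x - (x + t) / x * κ x) x :=
    fun x hx => by
      refine ((h.deriv_one x hx).sub (h.deriv_two x hx)).congr_deriv ?_
      field_simp
      ring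
  set P : ℝ := 1 / t + 1
  set M : ℝ := 2 * X + |k| + 1
  set L : ℝ := 3 * (2 * P + 2 * (M * P + 1) + 2 * ((M * P + 1) * P))
  have hP : 1 ≤ P := by
    have : 0 < 1 / t := by positivity
    simp only [P]; linarith
  have hM : 0 ≤ M := by simp only [M]; have := abs_nonneg k; linarith
  have dN : ∀ x, 0 < x → HasDerivAt (fun x => -(Real.exp (-L * x) * (ψ x ^ 2 + g x ^ 2 + δ x ^ 2)))
      (-(Real.exp (-L * x) * (-L * (ψ x ^ 2 + g x ^ 2 + δ x ^ 2) + (2 * ψ x * φ₁ x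
        + 2 * g x * ((2 * x - k + 1) * φ₁ x + ψ x)
        + 2 * δ x * (((2 * x - k) * φ₁ x + ψ x) / x - (x + t) / x * κ x))))) x := fun x hx => by
    have he : HasDerivAt (fun x : ℝ => Real.exp (-L * x)) (Real.exp (-L * x) * (-L)) x := by
      simpa using ((hasDerivAt_id x).const_mul (-L)).exp
    refine (he.mul ((((h.deriv_psi x hx).pow 2).add ((dg x hx).pow 2)).add
      ((dδ x hx).pow 2))).neg.congr_deriv ?_
    simp only [Pi.add_apply, Pi.pow_apply]
    push_cast
    ring
  have hm := monotoneOn_Icc_of_hasDerivAt (a := t) (c := X)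
    (fun x hx => dN x (ht.trans_le hx.1)) (fun x hx => by
      have hx0 : 0 < x := ht.trans hx.1
      have hxt : 0 < x - t := by linarith [hx.1]
      -- the singular term has a sign, because `κ` is a positive multiple of `δ` for `x > t`
      have hsing : 0 ≤ δ x * ((x + t) / x * κ x) := by
        have e : κ x = δ x / (2 * (x - t)) := by
          rw [eq_div_iff (by positivity)]
          linarith [h.rel x hx0]
        rw [e]
        have : δ x * ((x + t) / x * (δ x / (2 * (x - t))))
            = δ x ^ 2 * ((x + t) / x / (2 * (x - t))) := by ring
        rw [this]
        positivity
      set n : ℝ := |ψ x| + |g x| + |δ x|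
      have aψ := abs_nonneg (ψ x)
      have ag := abs_nonneg (g x)
      have aδ := abs_nonneg (δ x)
      have hn : 0 ≤ n := by positivity
      have hn2 : n ^ 2 ≤ 3 * (ψ x ^ 2 + g x ^ 2 + δ x ^ 2) := by
        rw [← sq_abs (ψ x), ← sq_abs (g x), ← sq_abs (δ x)]
        simp only [n]
        nlinarith [sq_nonneg (|ψ x| - |g x|), sq_nonneg (|ψ x| - |δ x|),
          sq_nonneg (|g x| - |δ x|)]
      have hφ : |φ₁ x| ≤ P * n := by
        have e : φ₁ x = (1 / (x + t)) * g x + (t / (x + t)) * δ x := by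
          simp only [g, δ]; field_simp; ring
        have e1 : 1 / (x + t) ≤ P := by
          have : 1 / (x + t) ≤ 1 / t := one_div_le_one_div_of_le ht (by linarith)
          simp only [P]; linarith
        have e2 : t / (x + t) ≤ P := by
          refine le_trans ?_ hP
          rw [div_le_one (by positivity)]; linarith
        calc |φ₁ x| ≤ |1 / (x + t) * g x| + |t / (x + t) * δ x| := by
              rw [e]; exact abs_add_le _ _
          _ = 1 / (x + t) * |g x| + t / (x + t) * |δ x| := by
              rw [abs_mul, abs_mul, abs_of_pos (by positivity : 0 < 1 / (x + t)),
                abs_of_pos (by positivity : 0 < t / (x + t))]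
          _ ≤ P * |g x| + P * |δ x| := by gcongr
          _ ≤ P * n := by simp only [n]; nlinarith
      have hM1 : |2 * x - k + 1| ≤ M := by
        rw [abs_le]; simp only [M]
        constructor <;> linarith [neg_abs_le k, le_abs_self k, hx.2]
      have hM2 : |2 * x - k| ≤ M := by
        rw [abs_le]; simp only [M]
        constructor <;> linarith [neg_abs_le k, le_abs_self k, hx.2]
      have hψn : |ψ x| ≤ n := by simp only [n]; linarith
      have hgn : |g x| ≤ n := by simp only [n]; linarith
      have hδn : |δ x| ≤ n := by simp only [n]; linarith
      have hlin : ∀ c, |c| ≤ M → |c * φ₁ x + ψ x| ≤ (M * P + 1) * n := fun c hc => by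
        calc |c * φ₁ x + ψ x| ≤ |c| * |φ₁ x| + |ψ x| := by
              rw [← abs_mul]; exact abs_add_le _ _
          _ ≤ M * (P * n) + n := by gcongr
          _ = (M * P + 1) * n := by ring
      have t1 : 2 * ψ x * φ₁ x ≤ 2 * P * n ^ 2 := by
        calc 2 * ψ x * φ₁ x ≤ 2 * (|ψ x| * |φ₁ x|) := by
              rw [← abs_mul]; linarith [le_abs_self (ψ x * φ₁ x)]
          _ ≤ 2 * (n * (P * n)) := by gcongr
          _ = 2 * P * n ^ 2 := by ring
      have t2 : 2 * g x * ((2 * x - k + 1) * φ₁ x + ψ x) ≤ 2 * (M * P + 1) * n ^ 2 := by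
        calc 2 * g x * ((2 * x - k + 1) * φ₁ x + ψ x)
            ≤ 2 * (|g x| * |(2 * x - k + 1) * φ₁ x + ψ x|) := by
              rw [← abs_mul]; linarith [le_abs_self (g x * ((2 * x - k + 1) * φ₁ x + ψ x))]
          _ ≤ 2 * (n * ((M * P + 1) * n)) := by gcongr; exact hlin _ hM1
          _ = 2 * (M * P + 1) * n ^ 2 := by ring
      have t3 : 2 * δ x * (((2 * x - k) * φ₁ x + ψ x) / x) ≤ 2 * ((M * P + 1) * P) * n ^ 2 := by
        have hxP : 1 / x ≤ P := by
          have : 1 / x ≤ 1 / t := one_div_le_one_div_of_le ht hx.1.le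
          simp only [P]; linarith
        calc 2 * δ x * (((2 * x - k) * φ₁ x + ψ x) / x)
            = 2 * (δ x * ((2 * x - k) * φ₁ x + ψ x)) * (1 / x) := by ring
          _ ≤ 2 * (|δ x| * |(2 * x - k) * φ₁ x + ψ x|) * (1 / x) := by
              rw [← abs_mul]; gcongr; exact le_abs_self _
          _ ≤ 2 * (n * ((M * P + 1) * n)) * P := by gcongr; exact hlin _ hM2
          _ = 2 * ((M * P + 1) * P) * n ^ 2 := by ring
      have hC : 0 ≤ 2 * P + 2 * (M * P + 1) + 2 * ((M * P + 1) * P) := by positivity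
      have t4 := mul_le_mul_of_nonneg_left hn2 hC
      rw [neg_nonneg]
      refine mul_nonpos_of_nonneg_of_nonpos (Real.exp_pos _).le ?_
      simp only [L]
      linarith)
  have := hm ⟨le_rfl, hX⟩ ⟨hX, le_rfl⟩ hX
  simp only [g, δ, hψ, hφ₁, hφ₂] at this
  have h1 : Real.exp (-L * X) * (ψ X ^ 2 + g X ^ 2 + δ X ^ 2) ≤ 0 := by
    simp only [g, δ]; linarith
  have h2 : ψ X ^ 2 ≤ 0 := by
    by_contra hc
    have : 0 < ψ X ^ 2 + g X ^ 2 + δ X ^ 2 := by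
      have := sq_nonneg (g X); have := sq_nonneg (δ X); linarith
    exact absurd h1 (not_le.2 (mul_pos (Real.exp_pos _) this))
  nlinarith

end IsRadialSystem

/-! ### The case of definite `T` -/

section Definite

variable {k : ℝ} {b : ℝ × ℝ × ℝ → ℝ}

/-- For `S = -1` a solution is invariant under rotations. -/
theorem IsSkewSystem.rotation_invariant (hb : IsSkewSystem k (-1) 0 (-1) b) {u r : ℝ}
    (hv : (u + r, 0, u - r) ∈ posCone) (θ : ℝ) :
    b (u + r * Real.cos θ, r * Real.sin θ, u - r * Real.cos θ) = b (u + r, 0, u - r) := by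
  have h1 : 0 < u + r := hv.1
  have h2 : 0 < u - r := posCone_pos_right hv
  have hcurve : ∀ θ : ℝ,
      (u + r * Real.cos θ, r * Real.sin θ, u - r * Real.cos θ) ∈ posCone := fun θ => by
    have hsc := Real.sin_sq_add_cos_sq θ
    refine ⟨?_, ?_⟩
    · simp only
      have hr : |r| < u := abs_lt.2 ⟨by linarith, by linarith⟩
      have hrc : |r * Real.cos θ| ≤ |r| := by
        rw [abs_mul]
        exact mul_le_of_le_one_right (abs_nonneg r) (Real.abs_cos_le_one θ)
      linarith [neg_abs_le (r * Real.cos θ)]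
    · have : (u + r * Real.cos θ) * (u - r * Real.cos θ) - (r * Real.sin θ) ^ 2
          = (u + r) * (u - r) := by linear_combination (-r ^ 2) * hsc
      simp only
      rw [this]; positivity
  have hder : ∀ θ : ℝ, HasDerivAt
      (fun θ => b (u + r * Real.cos θ, r * Real.sin θ, u - r * Real.cos θ)) 0 θ := by
    intro θ
    refine (hasDerivAt_comp_curve hb.smooth (((Real.hasDerivAt_cos θ).const_mul r).const_add u)
      ((Real.hasDerivAt_sin θ).const_mul r) (((Real.hasDerivAt_cos θ).const_mul r).const_sub u)
      (hcurve θ)).congr_deriv ?_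
    have := hb.symm_eq _ _ _ (hcurve θ)
    simp only [smul_eq_mul] at this ⊢
    linear_combination (-1 : ℝ) * this
  have := is_const_of_deriv_eq_zero (fun t => (hder t).differentiableAt) (fun t => (hder t).deriv)
    θ 0
  simpa using this

/-- `e^x b(x, 0, t)` and its companions satisfy the transversal ordinary differential system. -/
theorem IsSkewSystem.isRadialSystem (hb : IsSkewSystem k (-1) 0 (-1) b) {t : ℝ} (ht : 0 < t) :
    IsRadialSystem k t (fun x => Real.exp x * b (x, 0, t))
      (fun x => Real.exp x * (pdX b (x, 0, t) + b (x, 0, t)))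
      (fun x => Real.exp x * (pdW b (x, 0, t) + b (x, 0, t)))
      (fun x => Real.exp x * (1 / 4 * pdY (pdY b) (x, 0, t))) := by
  have hX := contDiffOn_dirDeriv hb.smooth (1, 0, 0)
  have hW := contDiffOn_dirDeriv hb.smooth (0, 0, 1)
  refine ⟨fun x hx => ?_, fun x hx => ?_, fun x hx => ?_, fun x hx => ?_⟩
  · refine ((Real.hasDerivAt_exp x).mul (hasDerivAt_along_x hb.smooth hx ht)).congr_deriv ?_
    ring
  · refine ((Real.hasDerivAt_exp x).mul ((hasDerivAt_along_x hX hx ht).add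
      (hasDerivAt_along_x hb.smooth hx ht))).congr_deriv ?_
    have := hb.eq_XX _ _ _ (posCone_diag hx ht)
    simp only [smul_eq_mul] at this
    simp only [Pi.add_apply]
    rw [eq_div_iff hx.ne']
    linear_combination (Real.exp x) * this
  · refine ((Real.hasDerivAt_exp x).mul ((hasDerivAt_along_x hW hx ht).add
      (hasDerivAt_along_x hb.smooth hx ht))).congr_deriv ?_
    have := hb.det_eq _ _ _ (posCone_diag hx ht)
    simp only [smul_eq_mul] at this
    simp only [Pi.add_apply]
    linear_combination (Real.exp x) * this
  · have := hb.symm_eq_deriv hx ht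
    linear_combination (-(Real.exp x) / 2) * this

theorem hasDerivAt_along_diag {f : ℝ × ℝ × ℝ → ℝ} (hf : ContDiffOn ℝ ∞ f posCone) {u : ℝ}
    (hu : 0 < u) :
    HasDerivAt (fun u => f (u, 0, u)) (pdX f (u, 0, u) + pdW f (u, 0, u)) u := by
  refine (hasDerivAt_comp_curve hf (hasDerivAt_id u) (hasDerivAt_const u 0) (hasDerivAt_id u)
    (posCone_diag hu hu)).congr_deriv (by simp)

/-- On scalar matrices `h(u) = b(u, 0, u)` satisfies a second-order equation that factors through
`u h' + (k - 1) h`; when that quantity vanishes at one point, `h` is a multiple of `u^(1 - k)`. -/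
theorem IsSkewSystem.diag_of_initial (hb : IsSkewSystem k (-1) 0 (-1) b)
    (h0 : pdX b (1, 0, 1) + pdW b (1, 0, 1) + (k - 1) * b (1, 0, 1) = 0) {u : ℝ} (hu : 0 < u) :
    b (u, 0, u) = b (1, 0, 1) * u ^ (1 - k) ∧
      u * (pdX b (u, 0, u) + pdW b (u, 0, u)) + (k - 1) * b (u, 0, u) = 0 := by
  have hX := contDiffOn_dirDeriv hb.smooth (1, 0, 0)
  have hW := contDiffOn_dirDeriv hb.smooth (0, 0, 1)
  set q : ℝ → ℝ := fun u => u * (pdX b (u, 0, u) + pdW b (u, 0, u)) + (k - 1) * b (u, 0, u)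
  have hq : ∀ u, 0 < u → HasDerivAt (fun u => Real.exp (2 * u) * q u) 0 u := by
    intro u hu
    have he : HasDerivAt (fun u : ℝ => Real.exp (2 * u)) (Real.exp (2 * u) * 2) u := by
      simpa using ((hasDerivAt_id u).const_mul 2).exp
    refine (he.mul (((hasDerivAt_id u).mul ((hasDerivAt_along_diag hX hu).add
      (hasDerivAt_along_diag hW hu))).add
        ((hasDerivAt_along_diag hb.smooth hu).const_mul (k - 1)))).congr_deriv ?_
    have hv := posCone_diag hu hu
    have e1 := hb.eq_XX _ _ _ hv
    have e2 := hb.eq_WW _ _ _ hv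
    have e3 := hb.det_eq _ _ _ hv
    have e4 : pdW (pdX b) (u, 0, u) = pdX (pdW b) (u, 0, u) := dirDeriv_comm hb.smooth hv _ _
    simp only [smul_eq_mul] at e1 e2 e3
    simp only [Pi.add_apply, Pi.mul_apply, id]
    rw [e4]
    linear_combination (Real.exp (2 * u)) * (e1 + e2 + 2 * u * e3)
  have hq0 : ∀ u, 0 < u → q u = 0 := fun u hu => by
    have h1 := eq_of_hasDerivAt_zero_Ioi hq hu one_pos
    have h2 : q 1 = 0 := by simp only [q]; linarith
    rw [h2, mul_zero, mul_eq_zero, or_iff_right (Real.exp_pos _).ne'] at h1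
    exact h1
  refine ⟨?_, hq0 u hu⟩
  have hh : ∀ u, 0 < u → HasDerivAt (fun u => u ^ (k - 1) * b (u, 0, u)) 0 u := by
    intro u hu
    have hp : HasDerivAt (fun u : ℝ => u ^ (k - 1)) ((k - 1) * u ^ (k - 1 - 1)) u :=
      Real.hasDerivAt_rpow_const (.inl hu.ne')
    refine (hp.mul (hasDerivAt_along_diag hb.smooth hu)).congr_deriv ?_
    have := hq0 u hu
    simp only [q] at this
    rw [Real.rpow_sub_one hu.ne']
    have e : pdX b (u, 0, u) + pdW b (u, 0, u) = -((k - 1) * b (u, 0, u)) / u := by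
      rw [eq_div_iff hu.ne']; linarith
    rw [e]; ring
  have h1 := eq_of_hasDerivAt_zero_Ioi hh hu one_pos
  rw [Real.one_rpow, one_mul] at h1
  rw [← h1, mul_comm, ← mul_assoc, ← Real.rpow_add hu]
  simp

/-- The algebraic solution `u^(1 - k)` on scalar matrices does not extend with polynomial growth. -/
theorem IsSkewSystem.value_ne_one_of_growth (hb : IsSkewSystem k (-1) 0 (-1) b) (hk : 1 ≤ k)
    (hg : HasRayGrowth b)
    (h0 : pdX b (1, 0, 1) + pdW b (1, 0, 1) + (k - 1) * b (1, 0, 1) = 0) : b (1, 0, 1) ≠ 1 := by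
  intro hone
  set c : ℝ := (1 / 8) * 3 ^ (1 / 2 - k) * Real.exp (-4)
  have hc : 0 < c := by positivity
  have hlow : ∀ t, k ≤ t → c * (t ^ (-k) * Real.exp (2 * t)) ≤ b (3 * t, 0, t) := by
    intro t hkt
    have ht : 1 ≤ t := hk.trans hkt
    have ht0 : 0 < t := by linarith
    obtain ⟨d1, d2⟩ := hb.diag_of_initial h0 ht0
    rw [hone, one_mul] at d1
    have hbpos : 0 < b (t, 0, t) := by rw [d1]; positivity
    have hXW : pdX b (t, 0, t) = pdW b (t, 0, t) := by
      have := hb.symm_eq_deriv ht0 ht0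
      linarith
    have hW : b (t, 0, t) / 2 ≤ pdW b (t, 0, t) + b (t, 0, t) := by
      rw [hXW] at d2
      have : 0 ≤ t * (pdW b (t, 0, t) + b (t, 0, t) - b (t, 0, t) / 2) := by
        nlinarith
      linarith [nonneg_of_mul_nonneg_right this ht0]
    have h := (hb.isRadialSystem ht0).lower_bound ht hkt hk
      (mul_pos (Real.exp_pos t) hbpos) (mul_pos (Real.exp_pos t) (by linarith))
    have hpow : t ^ (-k) = t ^ (1 - k) / t := by
      rw [← Real.rpow_sub_one ht0.ne']; congr 1; ring
    refine le_of_mul_le_mul_left ?_ (Real.exp_pos (3 * t))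
    refine le_trans ?_ h
    have e5 : Real.exp (3 * t) * Real.exp (2 * t) = Real.exp t * Real.exp (4 * t) := by
      rw [← Real.exp_add, ← Real.exp_add]; congr 1; ring
    calc Real.exp (3 * t) * (c * (t ^ (-k) * Real.exp (2 * t)))
        = (1 / 4) * 3 ^ (1 / 2 - k) * Real.exp (-4) * ((t ^ (1 - k) / 2)
          * (Real.exp (3 * t) * Real.exp (2 * t)) / t) := by
          rw [hpow]; simp only [c]; ring
      _ = (1 / 4) * 3 ^ (1 / 2 - k) * Real.exp (-4) * ((Real.exp t * (b (t, 0, t) / 2))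
          * Real.exp (4 * t) / t) := by rw [e5, d1]; ring
      _ ≤ _ := by gcongr
  obtain ⟨r, hr⟩ := hg (3, 0, 1) (posCone_diag (by norm_num) one_pos)
  have h1 : (fun t : ℝ => t ^ (-k) * Real.exp (2 * t)) =O[atTop] fun t : ℝ => t ^ r := by
    refine IsBigO.trans (IsBigO.of_bound c⁻¹ ?_) hr
    filter_upwards [eventually_ge_atTop k] with t ht
    have ht0 : 0 < t := by linarith
    have := hlow t ht
    have hp : 0 ≤ t ^ (-k) * Real.exp (2 * t) := by positivity
    rw [Real.norm_of_nonneg hp, ← div_eq_inv_mul, le_div_iff₀ hc, mul_comm]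
    refine this.trans ?_
    simp only [Prod.smul_mk, smul_eq_mul, mul_one, mul_zero]
    rw [mul_comm t 3]
    exact le_abs_self _
  have h2 : (fun t : ℝ => Real.exp (2 * t)) =O[atTop] fun t : ℝ => t ^ (r + k) := by
    have := (isBigO_refl (fun t : ℝ => t ^ k) atTop).mul h1
    refine this.congr' ?_ ?_ <;> filter_upwards [eventually_gt_atTop 0] with t ht
    · rw [← mul_assoc, ← Real.rpow_add ht]; simp
    · rw [← Real.rpow_add ht, add_comm]
  refine (isLittleO_irrefl' (f' := fun t : ℝ => Real.exp (2 * t)) ?_)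
    (h2.trans_isLittleO (isLittleO_rpow_exp_pos_mul_atTop (r + k) two_pos))
  exact .of_forall fun s => by simp

/-- For `S = -1`, a solution of ray growth is determined by the value of one linear functional. -/
theorem IsSkewSystem.eq_zero_of_definite (hb : IsSkewSystem k (-1) 0 (-1) b) (hk : 1 ≤ k)
    (hg : HasRayGrowth b)
    (h0 : pdX b (1, 0, 1) + pdW b (1, 0, 1) + (k - 1) * b (1, 0, 1) = 0) :
    ∀ v ∈ posCone, b v = 0 := by
  have hone : b (1, 0, 1) = 0 := by
    by_contra hne
    set L : ℝ →L[ℝ] ℝ := (b (1, 0, 1))⁻¹ • ContinuousLinearMap.id ℝ ℝ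
    have hv : ((1 : ℝ), (0 : ℝ), (1 : ℝ)) ∈ posCone := posCone_diag one_pos one_pos
    refine (hb.clm_comp L).value_ne_one_of_growth hk (hg.clm_comp L) ?_ ?_
    · simp only [dirDeriv_clm_comp L hb.smooth hv, L]
      simp only [_root_.smul_apply, ContinuousLinearMap.id_apply, smul_eq_mul]
      linear_combination (b (1, 0, 1))⁻¹ * h0
    · simp [L, hne]
  have hdiag : ∀ x t, 0 < t → t ≤ x → b (x, 0, t) = 0 := by
    intro x t ht hx
    obtain ⟨d1, d2⟩ := hb.diag_of_initial h0 ht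
    rw [hone, zero_mul] at d1
    have d3 := hb.symm_eq_deriv ht ht
    rw [d1, mul_zero, add_zero, mul_eq_zero, or_iff_right ht.ne'] at d2
    have hX : pdX b (t, 0, t) = 0 := by linarith
    have hW : pdW b (t, 0, t) = 0 := by linarith
    have := (hb.isRadialSystem ht).eq_zero_of_initial_zero ht (by simp [d1]) (by simp [d1, hX])
      (by simp [d1, hW]) hx
    simpa using this
  -- every matrix is a rotation of a diagonal one
  rintro ⟨x, y, w⟩ hv
  set z : ℂ := ⟨(x - w) / 2, y⟩
  have hx : 0 < x := hv.1
  have hw : 0 < w := posCone_pos_right hv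
  have hd : 0 < x * w - y ^ 2 := hv.2
  have hz2 : ‖z‖ ^ 2 = ((x - w) / 2) ^ 2 + y ^ 2 := by
    rw [← Complex.normSq_eq_norm_sq, Complex.normSq_mk]; ring
  have hz : ‖z‖ < (x + w) / 2 := by
    refine lt_of_pow_lt_pow_left₀ 2 (by positivity) ?_
    rw [hz2]; nlinarith
  have hcone := posCone_diag (x := (x + w) / 2 + ‖z‖) (w := (x + w) / 2 - ‖z‖)
    (by positivity) (by linarith)
  have hrot := hb.rotation_invariant hcone (Complex.arg z)
  have hre : ‖z‖ * Real.cos (Complex.arg z) = (x - w) / 2 := Complex.norm_mul_cos_arg z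
  have him : ‖z‖ * Real.sin (Complex.arg z) = y := Complex.norm_mul_sin_arg z
  rw [hre, him, show (x + w) / 2 + (x - w) / 2 = x by ring,
    show (x + w) / 2 - (x - w) / 2 = w by ring] at hrot
  rw [hrot]
  exact hdiag _ _ (by linarith) (by linarith [norm_nonneg z])

end Definite

/-! ### Normal forms and the conclusion -/

theorem dirDeriv_sub {E : Type*} [NormedAddCommGroup E] [NormedSpace ℝ E] {b₁ b₂ : ℝ × ℝ × ℝ → E}
    (h₁ : ContDiffOn ℝ ∞ b₁ posCone) (h₂ : ContDiffOn ℝ ∞ b₂ posCone) (e : ℝ × ℝ × ℝ) :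
    EqOn (dirDeriv e fun v => b₁ v - b₂ v) (fun v => dirDeriv e b₁ v - dirDeriv e b₂ v)
      posCone := by
  intro v hv
  have h := (differentiableAt_of_mem_posCone h₁ hv).hasFDerivAt.sub
    (differentiableAt_of_mem_posCone h₂ hv).hasFDerivAt
  rw [dirDeriv, HasFDerivAt.fderiv (f := fun v => b₁ v - b₂ v) h]
  rfl

theorem IsSkewSystem.sub {E : Type*} [NormedAddCommGroup E] [NormedSpace ℝ E] {k s₁ s₂ s₃ : ℝ}
    {b₁ b₂ : ℝ × ℝ × ℝ → E} (h₁ : IsSkewSystem k s₁ s₂ s₃ b₁) (h₂ : IsSkewSystem k s₁ s₂ s₃ b₂) :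
    IsSkewSystem k s₁ s₂ s₃ (fun v => b₁ v - b₂ v) := by
  have hD := fun v (hv : v ∈ posCone) e => dirDeriv_sub h₁.smooth h₂.smooth e hv
  have hDD : ∀ v ∈ posCone, ∀ e e', dirDeriv e (dirDeriv e' fun v => b₁ v - b₂ v) v
      = dirDeriv e (dirDeriv e' b₁) v - dirDeriv e (dirDeriv e' b₂) v := fun v hv e e' =>
    (dirDeriv_congr (dirDeriv_sub h₁.smooth h₂.smooth e') e hv).trans
      (dirDeriv_sub (contDiffOn_dirDeriv h₁.smooth e')
        (contDiffOn_dirDeriv h₂.smooth e') e hv)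
  refine ⟨h₁.smooth.sub h₂.smooth, ?_, ?_, ?_, ?_, ?_⟩ <;> intro x y w hv <;>
    simp only [hD _ hv, hDD _ hv]
  · linear_combination (norm := module) h₁.det_eq x y w hv - h₂.det_eq x y w hv
  · linear_combination (norm := module) h₁.symm_eq x y w hv - h₂.symm_eq x y w hv
  · linear_combination (norm := module) h₁.eq_XX x y w hv - h₂.eq_XX x y w hv
  · linear_combination (norm := module) h₁.eq_XW x y w hv - h₂.eq_XW x y w hv
  · linear_combination (norm := module) h₁.eq_WW x y w hv - h₂.eq_WW x y w hv

theorem HasRayGrowth.sub {E : Type*} [NormedAddCommGroup E] [NormedSpace ℝ E]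
    {b₁ b₂ : ℝ × ℝ × ℝ → E} (h₁ : HasRayGrowth b₁) (h₂ : HasRayGrowth b₂) :
    HasRayGrowth (fun v => b₁ v - b₂ v) := by
  intro v hv
  obtain ⟨r₁, hr₁⟩ := h₁ v hv
  obtain ⟨r₂, hr₂⟩ := h₂ v hv
  have hmono : ∀ r r' : ℝ, r ≤ r' →
      (fun t : ℝ => t ^ r) =O[atTop] fun t : ℝ => t ^ r' := fun r r' h => by
    refine IsBigO.of_bound 1 ?_
    filter_upwards [eventually_ge_atTop 1] with t ht
    rw [one_mul, Real.norm_of_nonneg (by positivity), Real.norm_of_nonneg (by positivity)]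
    exact Real.rpow_le_rpow_of_exponent_le ht h
  exact ⟨max r₁ r₂, (hr₁.trans (hmono _ _ (le_max_left _ _))).sub
    (hr₂.trans (hmono _ _ (le_max_right _ _)))⟩

theorem exists_congrMap_eq {p q r s : ℝ} (hg : p * s - q * r ≠ 0) {v : ℝ × ℝ × ℝ}
    (hv : v ∈ posCone) : ∃ u ∈ posCone, congrMap p q r s u = v := by
  set Δ := p * s - q * r
  have hg' : s / Δ * (p / Δ) - -q / Δ * (-r / Δ) ≠ 0 := by
    have : s / Δ * (p / Δ) - -q / Δ * (-r / Δ) = 1 / Δ := by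
      field_simp; simp only [Δ]; ring
    rw [this]; positivity
  refine ⟨congrMap (s / Δ) (-q / Δ) (-r / Δ) (p / Δ) v, mapsTo_congrMap hg' hv, ?_⟩
  obtain ⟨x, y, w⟩ := v
  simp only [congrMap_apply, Prod.mk.injEq]
  refine ⟨?_, ?_, ?_⟩ <;> field_simp <;> simp only [Δ] <;> ring

theorem exists_symMat_congrMap_eq {p q r s : ℝ} (hg : p * s - q * r ≠ 0)
    {Y : Matrix (Fin 2) (Fin 2) ℝ} (hY : Y.PosDef) :
    ∃ u ∈ posCone, symMat (congrMap p q r s u) = Y := by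
  have h := eq_symMat_of_isHermitian hY.1
  rw [h] at hY
  obtain ⟨u, hu, huv⟩ := exists_congrMap_eq hg (posDef_symMat_iff.1 hY)
  exact ⟨u, hu, by rw [huv, ← h]⟩

/-- A singular nonzero negative semidefinite form is congruent to `diag(-1, 0)`. -/
theorem exists_normalForm_singular {s₁ s₂ s₃ : ℝ} (h₁ : s₁ ≤ 0) (h₃ : s₃ ≤ 0)
    (hd : s₁ * s₃ = s₂ ^ 2) (hne : s₁ ≠ 0 ∨ s₂ ≠ 0 ∨ s₃ ≠ 0) :
    ∃ p q r s : ℝ, p * s - q * r ≠ 0 ∧ -1 = p ^ 2 * s₁ + 2 * p * r * s₂ + r ^ 2 * s₃ ∧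
      0 = p * q * s₁ + (p * s + q * r) * s₂ + r * s * s₃ ∧
      0 = q ^ 2 * s₁ + 2 * q * s * s₂ + s ^ 2 * s₃ := by
  by_cases h : s₁ = 0
  · have h2 : s₂ = 0 := by
      rw [h, zero_mul] at hd
      exact pow_eq_zero_iff (two_ne_zero) |>.1 hd.symm
    have h3 : 0 < -s₃ := by
      rcases hne with h' | h' | h'
      · exact absurd h h'
      · exact absurd h2 h'
      · have := lt_of_le_of_ne h₃ h'; linarith
    have hs := Real.sqrt_pos.2 h3
    have hs2 := Real.sq_sqrt h3.le
    refine ⟨0, 1, 1 / √(-s₃), 0, ?_, ?_, ?_, ?_⟩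
    · have : 0 < 1 / √(-s₃) := by positivity
      intro h0; linarith
    · have h3' : s₃ ≠ 0 := by rintro rfl; simp at h3
      rw [h, h2, div_pow, hs2]; field_simp; ring
    · rw [h2]; ring
    · rw [h]; ring
  · have h1 : 0 < -s₁ := by have := lt_of_le_of_ne h₁ h; linarith
    have hs := Real.sqrt_pos.2 h1
    have hs2 := Real.sq_sqrt h1.le
    refine ⟨1 / √(-s₁), -s₂ / s₁, 0, 1, ?_, ?_, ?_, ?_⟩
    · have : 0 < 1 / √(-s₁) := by positivity
      intro h0; linarith
    · rw [div_pow, hs2]; field_simp; ring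
    · field_simp; ring
    · field_simp; linear_combination (-1 : ℝ) * hd

/-- A negative definite form is congruent to `-1`. -/
theorem exists_normalForm_definite {s₁ s₂ s₃ : ℝ} (h₁ : s₁ < 0) (hd : 0 < s₁ * s₃ - s₂ ^ 2) :
    ∃ p q r s : ℝ, p * s - q * r ≠ 0 ∧ -1 = p ^ 2 * s₁ + 2 * p * r * s₂ + r ^ 2 * s₃ ∧
      0 = p * q * s₁ + (p * s + q * r) * s₂ + r * s * s₃ ∧
      -1 = q ^ 2 * s₁ + 2 * q * s * s₂ + s ^ 2 * s₃ := by
  have h1 : 0 < -s₁ := by linarith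
  have hs := Real.sqrt_pos.2 h1
  have hs2 := Real.sq_sqrt h1.le
  have hq : 0 < -s₁ / (s₁ * s₃ - s₂ ^ 2) := by positivity
  have hr := Real.sqrt_pos.2 hq
  have hr2 := Real.sq_sqrt hq.le
  set ρ := √(-s₁ / (s₁ * s₃ - s₂ ^ 2))
  rw [eq_div_iff hd.ne'] at hr2
  refine ⟨1 / √(-s₁), -s₂ / s₁ * ρ, 0, ρ, ?_, ?_, ?_, ?_⟩
  · have : 0 < 1 / √(-s₁) * ρ := by positivity
    intro h0; linarith
  · rw [div_pow, hs2]
    have := h₁.ne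
    field_simp; ring
  · have := h₁.ne
    field_simp; ring
  · have := h₁.ne
    field_simp
    linear_combination (-1 : ℝ) * hr2

section SpecialFunctions

variable {T : Matrix (Fin 2) (Fin 2) ℝ} {p q r s : ℝ}

theorem trace_mul_symMat_congrMap (hT : T.IsHermitian) {t₁ t₂ t₃ : ℝ}
    (h₁ : t₁ = p ^ 2 * (2 * Real.pi * T 0 0) + 2 * p * r * (2 * Real.pi * T 0 1)
      + r ^ 2 * (2 * Real.pi * T 1 1))
    (h₂ : t₂ = p * q * (2 * Real.pi * T 0 0) + (p * s + q * r) * (2 * Real.pi * T 0 1)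
      + r * s * (2 * Real.pi * T 1 1))
    (h₃ : t₃ = q ^ 2 * (2 * Real.pi * T 0 0) + 2 * q * s * (2 * Real.pi * T 0 1)
      + s ^ 2 * (2 * Real.pi * T 1 1)) (v : ℝ × ℝ × ℝ) :
    (T * symMat (congrMap p q r s v)).trace
      = (t₁ * v.1 + 2 * t₂ * v.2.1 + t₃ * v.2.2) / (2 * Real.pi) := by
  have h10 : T 1 0 = T 0 1 := by simpa using hT.apply 0 1
  rw [eq_div_iff (by positivity), h₁, h₂, h₃]
  simp [Matrix.trace_fin_two, Matrix.mul_apply, Fin.sum_univ_two, symMat, congrMap_apply, h10]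
  ring

theorem detTerm_congrMap (k : ℤ) (hg : p * s - q * r ≠ 0)
    (htr : ∀ v, (T * symMat (congrMap p q r s v)).trace = -v.1 / (2 * Real.pi)) :
    ∃ C : ℝ, C ≠ 0 ∧ ∀ x y w, (x, y, w) ∈ posCone →
      detTerm k T (symMat (congrMap p q r s (x, y, w)))
        = C * ((x * w - y ^ 2) ^ (3 / 2 - (k : ℝ)) * x ^ ((k : ℝ) - 2) * Real.exp (-x)) := by
  have hΔ : 0 < (p * s - q * r) ^ 2 := by positivity
  refine ⟨((p * s - q * r) ^ 2) ^ (3 / 2 - (k : ℝ)) * (-1 / (2 * Real.pi)) ^ (k - 2),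
    mul_ne_zero (Real.rpow_pos_of_pos hΔ _).ne' (zpow_ne_zero _ ?_), fun x y w hv => ?_⟩
  · have := Real.pi_pos
    exact (div_neg_of_neg_of_pos (by norm_num) (by positivity)).ne
  · have hx : 0 < x := hv.1
    have hd : 0 < x * w - y ^ 2 := hv.2
    have hpi := Real.pi_pos
    have habs : 2 * Real.pi * |-x / (2 * Real.pi)| = x := by
      rw [abs_div, abs_neg, abs_of_pos hx, abs_of_pos (by positivity)]
      field_simp
    have hdet : (symMat (congrMap p q r s (x, y, w))).det
        = (p * s - q * r) ^ 2 * (x * w - y ^ 2) := by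
      rw [det_symMat, congrMap_apply]; ring
    rw [detTerm, htr, habs, hdet, Real.mul_rpow hΔ.le hd.le,
      show -x / (2 * Real.pi) = -1 / (2 * Real.pi) * x by ring, mul_zpow, ← Real.rpow_intCast x]
    push_cast
    ring

theorem whittakerTerm_congrMap (k : ℤ)
    (htr : ∀ v, (T * symMat (congrMap p q r s v)).trace = -v.1 / (2 * Real.pi)) :
    ∃ C : ℝ, C ≠ 0 ∧ ∀ x y w, (x, y, w) ∈ posCone →
      whittakerTerm k T (symMat (congrMap p q r s (x, y, w))) = C * decayingSolution k x := by
  refine ⟨(Real.Gamma (1 / 2))⁻¹, inv_ne_zero (Real.Gamma_pos_of_pos (by norm_num)).ne',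
    fun x y w hv => ?_⟩
  have hx : 0 < x := hv.1
  have hpi := Real.pi_pos
  have habs : 4 * Real.pi * |-x / (2 * Real.pi)| = 2 * x := by
    rw [abs_div, abs_neg, abs_of_pos hx, abs_of_pos (by positivity)]
    field_simp
    ring
  have e1 : ((k : ℝ) - 1) / 2 - ((k : ℝ) - 1) / 2 + 1 / 2 = 1 / 2 := by ring
  have e2 : ((k : ℝ) - 1) / 2 - ((k : ℝ) - 1) / 2 - 1 / 2 = -1 / 2 := by ring
  have e3 : ((k : ℝ) - 1) / 2 + ((k : ℝ) - 1) / 2 - 1 / 2 = (k : ℝ) - 3 / 2 := by ring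
  have e4 : (2 * x) ^ (-((k : ℝ) / 2)) * (2 * x) ^ (((k : ℝ) - 1) / 2 + 1 / 2) = 1 := by
    rw [← Real.rpow_add (by positivity), show -((k : ℝ) / 2) + (((k : ℝ) - 1) / 2 + 1 / 2) = 0 by
      ring, Real.rpow_zero]
  have e5 : -(2 * x) / 2 = -x := by ring
  rw [whittakerTerm, htr, habs, whittakerW, e1, e2, e3, e5, decayingSolution, confluentIntegral]
  linear_combination (Real.exp (-x) * (Real.Gamma (1 / 2))⁻¹ *
    ∫ t in Ioi (0 : ℝ), Real.exp (-(2 * x) * t) * t ^ (-1 / 2 : ℝ)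
      * (1 + t) ^ ((k : ℝ) - 3 / 2)) * e4

end SpecialFunctions

/-- Skew-harmonicity and growth of a Fourier term, transported to a normal form of `T`. -/
theorem isSkewSystem_of_fourierTerm {k : ℤ} {T : Matrix (Fin 2) (Fin 2) ℝ} (hT : T.IsHermitian)
    {a : Matrix (Fin 2) (Fin 2) ℝ → ℂ} (ha : IsSkewHarmonic k (fourierTerm T a))
    (hm : HasModerateGrowth (fourierTerm T a)) {p q r s t₁ t₂ t₃ : ℝ} (hg : p * s - q * r ≠ 0)
    (h₁ : t₁ = p ^ 2 * (2 * Real.pi * T 0 0) + 2 * p * r * (2 * Real.pi * T 0 1)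
      + r ^ 2 * (2 * Real.pi * T 1 1))
    (h₂ : t₂ = p * q * (2 * Real.pi * T 0 0) + (p * s + q * r) * (2 * Real.pi * T 0 1)
      + r * s * (2 * Real.pi * T 1 1))
    (h₃ : t₃ = q ^ 2 * (2 * Real.pi * T 0 0) + 2 * q * s * (2 * Real.pi * T 0 1)
      + s ^ 2 * (2 * Real.pi * T 1 1)) :
    IsSkewSystem k t₁ t₂ t₃ (fun v => a (symMat (congrMap p q r s v))) ∧
      HasRayGrowth (fun v => a (symMat (congrMap p q r s v))) := by
  rw [fourierTerm_eq_expMode hT] at ha hm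
  exact ⟨ha.isSkewSystem.comp_congrMap hg h₁ h₂ h₃, hm.hasRayGrowth.comp_congrMap hg⟩

theorem fourierTerm_zero (T : Matrix (Fin 2) (Fin 2) ℝ) :
    fourierTerm T (fun _ => 0) = fun _ => 0 := by
  funext p; simp [fourierTerm]

theorem isSkewHarmonic_zero (k : ℤ) : IsSkewHarmonic k (fun _ => 0) := by
  have hw : ∀ e, wirtinger e (fun _ => (0 : ℂ)) = fun _ => 0 := fun e => by
    funext p; simp [wirtinger]
  have hwb : ∀ e, wirtingerBar e (fun _ => (0 : ℂ)) = fun _ => 0 := fun e => by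
    funext p; simp [wirtingerBar]
  have hz : ∀ p, dZ (fun _ => (0 : ℂ)) p = 0 := fun p => by
    ext i j; fin_cases i <;> fin_cases j <;> simp [dZ, hw]
  have hzb : ∀ p, dZbar (fun _ => (0 : ℂ)) p = 0 := fun p => by
    ext i j; fin_cases i <;> fin_cases j <;> simp [dZbar, hwb]
  refine ⟨contDiffOn_const, fun p _ => ⟨?_, ?_⟩⟩
  · have : secondOrderPart (fun _ => (0 : ℂ)) p = 0 := by
      ext i j; simp [secondOrderPart, hz, hzb]
    simp [skewOmega, this, hz, hzb]
  · simp [skewXi, hw]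

theorem hasModerateGrowth_zero : HasModerateGrowth (fun _ => 0) := fun _ _ =>
  ⟨0, isBigO_zero _ _⟩

theorem fourierCoeff_singular (k : ℤ) (hk : 3 < k) {T : Matrix (Fin 2) (Fin 2) ℝ} (hT0 : T ≠ 0)
    (hT : (-T).PosSemidef) (hdet : T.det = 0) :
    (∀ a : Matrix (Fin 2) (Fin 2) ℝ → ℂ, IsSkewHarmonic k (fourierTerm T a) →
      HasModerateGrowth (fourierTerm T a) →
      ∃ c₁ c₂ : ℂ, ∀ Y : Matrix (Fin 2) (Fin 2) ℝ, Y.PosDef →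
        a Y = c₁ * (detTerm k T Y : ℂ) + c₂ * (whittakerTerm k T Y : ℂ)) ∧
    (∀ c₁ c₂ : ℂ, (∀ Y : Matrix (Fin 2) (Fin 2) ℝ, Y.PosDef →
        c₁ * (detTerm k T Y : ℂ) + c₂ * (whittakerTerm k T Y : ℂ) = 0) → c₁ = 0 ∧ c₂ = 0) := by
  have hTh : T.IsHermitian := by simpa using hT.1.neg
  have h10 : T 1 0 = T 0 1 := by simpa using hTh.apply 0 1
  have hpi := Real.pi_pos
  have hd0 : T 0 0 ≤ 0 := by
    have := hT.diag_nonneg (i := 0); simpa using this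
  have hd1 : T 1 1 ≤ 0 := by
    have := hT.diag_nonneg (i := 1); simpa using this
  rw [Matrix.det_fin_two, h10] at hdet
  obtain ⟨p, q, r, s, hg, h₁, h₂, h₃⟩ := exists_normalForm_singular
    (s₁ := 2 * Real.pi * T 0 0) (s₂ := 2 * Real.pi * T 0 1) (s₃ := 2 * Real.pi * T 1 1)
    (mul_nonpos_of_nonneg_of_nonpos (by positivity) hd0)
    (mul_nonpos_of_nonneg_of_nonpos (by positivity) hd1)
    (by linear_combination (4 * Real.pi ^ 2) * hdet) (by
      by_contra! hc
      obtain ⟨e1, e2, e3⟩ := hc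
      have h2pi : 2 * Real.pi ≠ 0 := by positivity
      refine hT0 ?_
      ext i j
      fin_cases i <;> fin_cases j <;> simp_all)
  have htr : ∀ v, (T * symMat (congrMap p q r s v)).trace = -v.1 / (2 * Real.pi) := fun v => by
    rw [trace_mul_symMat_congrMap hTh h₁ h₂ h₃]; ring
  obtain ⟨C₁, hC₁, hdt⟩ := detTerm_congrMap k hg htr
  obtain ⟨C₂, hC₂, hwt⟩ := whittakerTerm_congrMap k htr
  have hk' : (3 : ℝ) < k := by exact_mod_cast hk
  constructor
  · intro a ha hm
    obtain ⟨hb, hgr⟩ := isSkewSystem_of_fourierTerm hTh ha hm hg h₁ h₂ h₃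
    obtain ⟨x₁, x₂, hx⟩ := (hb.clm_comp reCLM).eq_of_singular (by linarith) (hgr.clm_comp reCLM)
    obtain ⟨y₁, y₂, hy⟩ := (hb.clm_comp imCLM).eq_of_singular (by linarith) (hgr.clm_comp imCLM)
    refine ⟨(x₁ + y₁ * I) / C₁, (x₂ + y₂ * I) / C₂, fun Y hY => ?_⟩
    obtain ⟨⟨x, y, w⟩, hu, huv⟩ := exists_symMat_congrMap_eq hg hY
    have e1 := hx x y w hu
    have e2 := hy x y w hu
    rw [← huv, hdt x y w hu, hwt x y w hu,
      ← Complex.re_add_im (a (symMat (congrMap p q r s (x, y, w))))]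
    simp only [reCLM_apply, imCLM_apply] at e1 e2
    have hC₁' : (C₁ : ℂ) ≠ 0 := by exact_mod_cast hC₁
    have hC₂' : (C₂ : ℂ) ≠ 0 := by exact_mod_cast hC₂
    rw [e1, e2]
    push_cast
    field_simp
    ring
  · intro c₁ c₂ h
    have hv : ∀ w : ℝ, 0 < w → c₁ * ((C₁ * (w ^ (3 / 2 - (k : ℝ)) * Real.exp (-1)) : ℝ) : ℂ)
        + c₂ * ((C₂ * decayingSolution k 1 : ℝ) : ℂ) = 0 := fun w hw => by
      have hu := posCone_diag one_pos hw
      have := h _ (posDef_symMat_iff.2 (mapsTo_congrMap hg hu))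
      rw [hdt _ _ _ hu, hwt _ _ _ hu] at this
      simpa using this
    have hlt : (4 : ℝ) ^ (3 / 2 - (k : ℝ)) < 1 :=
      Real.rpow_lt_one_of_one_lt_of_neg (by norm_num) (by linarith)
    have e1 := hv 1 one_pos
    have e2 := hv 4 (by norm_num)
    rw [Real.one_rpow, one_mul] at e1
    have hc₁ : c₁ = 0 := by
      have e3 : c₁ * ((C₁ * Real.exp (-1) * (1 - 4 ^ (3 / 2 - (k : ℝ))) : ℝ) : ℂ) = 0 := by
        push_cast at e1 e2 ⊢
        linear_combination e1 - e2
      refine (mul_eq_zero.1 e3).resolve_right ?_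
      exact_mod_cast mul_ne_zero (mul_ne_zero hC₁ (Real.exp_pos _).ne') (by linarith)
    refine ⟨hc₁, ?_⟩
    rw [hc₁, zero_mul, zero_add] at e1
    refine (mul_eq_zero.1 e1).resolve_right ?_
    exact_mod_cast mul_ne_zero hC₂ (decayingSolution_pos k one_pos).ne'

theorem fourierCoeff_definite (k : ℤ) (hk : 3 < k) {T : Matrix (Fin 2) (Fin 2) ℝ}
    (hT : (-T).PosDef) :
    ∃ a₀ : Matrix (Fin 2) (Fin 2) ℝ → ℂ, IsSkewHarmonic k (fourierTerm T a₀) ∧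
      HasModerateGrowth (fourierTerm T a₀) ∧
      ∀ a : Matrix (Fin 2) (Fin 2) ℝ → ℂ, IsSkewHarmonic k (fourierTerm T a) →
        HasModerateGrowth (fourierTerm T a) →
        ∃ c : ℂ, ∀ Y : Matrix (Fin 2) (Fin 2) ℝ, Y.PosDef → a Y = c * a₀ Y := by
  have hTh : T.IsHermitian := by simpa using hT.1.neg
  have h10 : T 1 0 = T 0 1 := by simpa using hTh.apply 0 1
  have hpi := Real.pi_pos
  have hd0 : T 0 0 < 0 := by
    have := hT.diag_pos (i := 0); simpa using this
  have hdet := hT.det_pos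
  rw [Matrix.det_fin_two] at hdet
  simp only [Matrix.neg_apply, h10] at hdet
  obtain ⟨p, q, r, s, hg, h₁, h₂, h₃⟩ := exists_normalForm_definite
    (s₁ := 2 * Real.pi * T 0 0) (s₂ := 2 * Real.pi * T 0 1) (s₃ := 2 * Real.pi * T 1 1)
    (mul_neg_of_pos_of_neg (by positivity) hd0) (by
      have : 0 < 4 * Real.pi ^ 2 * (-T 0 0 * -T 1 1 - -T 0 1 * -T 0 1) := by positivity
      linarith)
  have hk' : (3 : ℝ) < k := by exact_mod_cast hk
  have hI : ((1 : ℝ), (0 : ℝ), (1 : ℝ)) ∈ posCone := posCone_diag one_pos one_pos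
  -- a linear functional that separates the solutions of moderate growth
  set ℓ : (ℝ × ℝ × ℝ → ℂ) → ℂ := fun b =>
    pdX b (1, 0, 1) + pdW b (1, 0, 1) + ((k : ℂ) - 1) * b (1, 0, 1)
  have hinj : ∀ b : ℝ × ℝ × ℝ → ℂ, IsSkewSystem k (-1) 0 (-1) b → HasRayGrowth b → ℓ b = 0 →
      ∀ v ∈ posCone, b v = 0 := by
    intro b hb hgr h0 v hv
    have hre := (hb.clm_comp reCLM).eq_zero_of_definite (by linarith) (hgr.clm_comp reCLM) (by
      simp only [dirDeriv_clm_comp reCLM hb.smooth hI]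
      simpa [ℓ] using congrArg Complex.re h0) v hv
    have him := (hb.clm_comp imCLM).eq_zero_of_definite (by linarith) (hgr.clm_comp imCLM) (by
      simp only [dirDeriv_clm_comp imCLM hb.smooth hI]
      simpa [ℓ] using congrArg Complex.im h0) v hv
    exact Complex.ext hre him
  by_cases hex : ∃ a₀ : Matrix (Fin 2) (Fin 2) ℝ → ℂ, IsSkewHarmonic k (fourierTerm T a₀) ∧
      HasModerateGrowth (fourierTerm T a₀) ∧ ℓ (fun v => a₀ (symMat (congrMap p q r s v))) ≠ 0
  · obtain ⟨a₀, ha₀, hm₀, hne⟩ := hex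
    refine ⟨a₀, ha₀, hm₀, fun a ha hm => ?_⟩
    obtain ⟨hb₀, hg₀⟩ := isSkewSystem_of_fourierTerm hTh ha₀ hm₀ hg h₁ h₂ h₃
    obtain ⟨hb, hgr⟩ := isSkewSystem_of_fourierTerm hTh ha hm hg h₁ h₂ h₃
    set b₀ : ℝ × ℝ × ℝ → ℂ := fun v => a₀ (symMat (congrMap p q r s v))
    set b : ℝ × ℝ × ℝ → ℂ := fun v => a (symMat (congrMap p q r s v))
    set c : ℂ := ℓ b / ℓ b₀
    set L : ℂ →L[ℝ] ℂ := ContinuousLinearMap.mul ℝ ℂ c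
    have hLb := hb₀.clm_comp L
    have hzero := hinj _ (hb.sub hLb) (hgr.sub (hg₀.clm_comp L)) (by
      simp only [ℓ]
      simp only [dirDeriv_sub hb.smooth hLb.smooth _ hI]
      simp only [dirDeriv_clm_comp L hb₀.smooth hI]
      simp only [L, ContinuousLinearMap.mul_apply']
      have : ℓ b - c * ℓ b₀ = 0 := by rw [div_mul_cancel₀ _ hne, sub_self]
      simp only [ℓ] at this
      linear_combination this)
    refine ⟨c, fun Y hY => ?_⟩
    obtain ⟨u, hu, huv⟩ := exists_symMat_congrMap_eq hg hY
    rw [← huv]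
    exact sub_eq_zero.1 (hzero u hu)
  · -- the functional vanishes on all solutions, so that zero is the only one
    push Not at hex
    refine ⟨fun _ => 0, ?_, ?_, fun a ha hm => ⟨0, fun Y hY => ?_⟩⟩
    · rw [fourierTerm_zero]; exact isSkewHarmonic_zero k
    · rw [fourierTerm_zero]; exact hasModerateGrowth_zero
    · obtain ⟨hb, hgr⟩ := isSkewSystem_of_fourierTerm hTh ha hm hg h₁ h₂ h₃
      obtain ⟨u, hu, huv⟩ := exists_symMat_congrMap_eq hg hY
      rw [zero_mul, ← huv]
      exact hinj _ hb hgr (hex a ha hm) u hu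

end SkewSiegel

theorem mainTheorem10 (k : ℤ) (hk : 3 < k) (hodd : Odd k) :
    (∀ T : Matrix (Fin 2) (Fin 2) ℝ, T ≠ 0 → (-T).PosSemidef → T.det = 0 →
      (∀ a : Matrix (Fin 2) (Fin 2) ℝ → ℂ,
        SkewSiegel.IsSkewHarmonic k (SkewSiegel.fourierTerm T a) →
        SkewSiegel.HasModerateGrowth (SkewSiegel.fourierTerm T a) →
        ∃ c₁ c₂ : ℂ, ∀ Y : Matrix (Fin 2) (Fin 2) ℝ, Y.PosDef →
          a Y = c₁ * (SkewSiegel.detTerm k T Y : ℂ) + c₂ * (SkewSiegel.whittakerTerm k T Y : ℂ)) ∧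
      (∀ c₁ c₂ : ℂ,
        (∀ Y : Matrix (Fin 2) (Fin 2) ℝ, Y.PosDef →
          c₁ * (SkewSiegel.detTerm k T Y : ℂ) + c₂ * (SkewSiegel.whittakerTerm k T Y : ℂ) = 0) →
        c₁ = 0 ∧ c₂ = 0)) ∧
    (∀ T : Matrix (Fin 2) (Fin 2) ℝ, (-T).PosDef →
      ∃ a₀ : Matrix (Fin 2) (Fin 2) ℝ → ℂ,
        SkewSiegel.IsSkewHarmonic k (SkewSiegel.fourierTerm T a₀) ∧
        SkewSiegel.HasModerateGrowth (SkewSiegel.fourierTerm T a₀) ∧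
        ∀ a : Matrix (Fin 2) (Fin 2) ℝ → ℂ,
          SkewSiegel.IsSkewHarmonic k (SkewSiegel.fourierTerm T a) →
          SkewSiegel.HasModerateGrowth (SkewSiegel.fourierTerm T a) →
          ∃ c : ℂ, ∀ Y : Matrix (Fin 2) (Fin 2) ℝ, Y.PosDef → a Y = c * a₀ Y) := by
  exact ⟨fun _ hT0 hT hdet => SkewSiegel.fourierCoeff_singular k hk hT0 hT hdet,
    fun _ hT => SkewSiegel.fourierCoeff_definite k hk hT⟩
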